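/- Vectors and matrices are over $\mathbb F_2$, $\mathrm{wt}$ is the Hamming weight, and $H_2(p)=-p\log_2p-(1-p)\log_2(1-p)$. An $m\times n$ matrix $H$ is dual-contained if its rows are orthogonal to themselves and to each other ($HH^{T}=0$). Let $\mathcal D_{m,n}$ be the set of dual-contained $m\times n$ matrices with linearly independent rows, and put $M(m,n)=2^{\,nm-m^2/2-m/2}$. "Random $H$" means uniformly distributed on $\mathcal D_{m,n}$. For even $n$, consider the following random construction of a matrix $[L\,|\,R]$ with two halves of width $n/2$. Fill the $m\times\frac n2$ matrix $L$ with independent fair bits, and halt if its rows are dependent. Then choose the rows of $R$ one after another, each uniformly among the vectors that make the new row of $[L\,|\,R]$ orthogonal to itself and to all earlier rows; halt if the rows of $R$ chosen so far together with the all-ones vector become linearly dependent. Let $\mathcal G_{m,n}$ be the set of matrices that this construction can output. 1. (Construction.) There is an absolute constant $C$ such that for all $\varepsilon>0$, all even $n$ and all $m\le \frac n2-n\varepsilon$ the construction halts without output with probability at most $C\,2^{-n\varepsilon}$. Always $\mathcal G_{m,n}\subseteq\mathcal D_{m,n}$. For every fixed $\varepsilon>0$, as $n\to\infty$ through even numbers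 and uniformly in $m\le\frac n2-n\varepsilon$, $|\mathcal G_{m,n}|/M(m,n)\to1$ and $|\mathcal G_{m,n}|/|\mathcal D_{m,n}|\to1$. 2. (Random dual-contained matrices.) For every fixed $\varepsilon>0$, as $n\to\infty$ and uniformly in $m\le\frac n2-n\varepsilon$: (a) $|\mathcal D_{m,n}|/M(m,n)\to1$; (b) uniformly over the sets $S$ of at most $n/2$ columns, the total variation distance between the law of the columns $S$ of a random $H$ and the uniform law on $m\times|S|$ matrices tends to $0$; (c) uniformly over $x\ne y$ in $\mathbb F_2^n$ with $\mathrm{wt}(x+y)<n/2$, $\;2^m\,\Pr[H(x+y)=0]\to1$. 3. (Correctable error fraction.) There is $\tau$ with $0.11<\tau<0.1101$ and $H_2(\tau)=\frac12$ such that for every $0\le p<\tau$ (in particular for $p=0.11$) one has $H_2(p)<\frac12$, and for every $\varepsilon>0$ with $H_2(p)<\frac12-\varepsilon$ the following holds with $m=m_n=\lfloor \frac n2-n\varepsilon\rfloor$. For $H\in\mathcal D_{m,n}$, a decoder $D:\mathbb F_2^m\to\mathbb F_2^n$ and $\eta>0$, say that $(H,D)$ is $(p,\eta)$-good if - for every integer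 $w$ with $0\le w\le pn$, a uniformly random error $x$ of weight $w$ satisfies $D(Hx)=x$ with probability at least $1-\eta$; and - for all integers $w_X,w_Z$ with $0\le w_X,w_Z\le pn$, if $x$, $z$ are independent uniformly random patterns of weights $w_X$, $w_Z$, then with probability at least $1-\eta$ the Pauli error $X^xZ^z$ is corrected, up to a global phase, on every state of the $X$–$Z$ symmetric CSS code on $n$ qubits whose stabilizer generators are $X^{h}$ and $Z^{h}$ for the rows $h$ of $H$, by measuring the generators and applying the $X$ and $Z$ corrections that $D$ assigns to the outcomes of the $Z$-type and of the $X$-type generators. Then for every $\eta>0$ the probability that a random $H\in\mathcal D_{m_n,n}$ has a decoder $D$ with $(H,D)$ $(p,\eta)$-good tends to $1$ as $n\to\infty$. Moreover there are $H_n\in\mathcal D_{m_n,n}$ and decoders $D_n$ for all $n$ such that the CSS code of $H_n$ has dimension $2^{\,n-2m_n}$ and, for every $\eta>0$, $(H_n,D_n)$ is $(p,\eta)$-good for all sufficiently large $n$. -/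

import Mathlib

open scoped Matrix Topology
open Filter

/-- Bit strings of length `n`. -/
abbrev Bits (n : ℕ) : Type := Fin n → ZMod 2

open Classical in
/-- The probability that a uniformly random element of the finite set `s` satisfies `P`. -/
noncomputable def frac {α : Type*} (s : Finset α) (P : α → Prop) : ℝ :=
  ((s.filter P).card : ℝ) / (s.card : ℝ)

/-- `H` is dual-contained: its rows are orthogonal to themselves and to each other, that is,
the span of the rows (the dual of the code with parity-check matrix `H`) is contained in
the code. -/
def IsDualContained {m n : ℕ} (H : Matrix (Fin m) (Fin n) (ZMod 2)) : Prop :=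
  H * Hᵀ = 0

open Classical in
/-- The dual-contained `m × n` parity-check matrices with linearly independent rows. -/
noncomputable def dualContained (m n : ℕ) : Finset (Matrix (Fin m) (Fin n) (ZMod 2)) :=
  Finset.univ.filter fun H => IsDualContained H ∧ LinearIndependent (ZMod 2) H.row

/-! ### The row-by-row construction of a dual-contained matrix `[L | R]` of width `h + h` -/

/-- The vectors `v` that may stand in `R` as its row after the rows `R 0, …, R (k - 1)`: with
`v` as the right half of the last row of `[L | R]`, that row is orthogonal to all earlier rows
and to itself. -/
def nextRows {k h : ℕ} (L : Fin (k + 1) → Bits h) (R : Fin k → Bits h) : Finset (Bits h) :=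
  Finset.univ.filter fun v =>
    (∀ j : Fin k, L (Fin.last k) ⬝ᵥ L j.castSucc + v ⬝ᵥ R j = 0) ∧
      L (Fin.last k) ⬝ᵥ L (Fin.last k) + v ⬝ᵥ v = 0

open Classical in
/-- Given `L`, choose the rows of `R` one after another, each uniformly among the vectors that
satisfy the orthogonality constraints. Halt (value `none`) as soon as the all-ones vector and
the rows of `R` chosen so far are linearly dependent. -/
noncomputable def buildRight {h : ℕ} :
    (k : ℕ) → (Fin k → Bits h) → PMF (Option (Fin k → Bits h))
  | 0, _ => PMF.pure (some Fin.elim0)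
  | k + 1, L => (buildRight k (Fin.init L)).bind fun o =>
      match o with
      | none => PMF.pure none
      | some R =>
        if hs : (nextRows L R).Nonempty then
          (PMF.uniformOfFinset (nextRows L R) hs).map fun v =>
            if LinearIndependent (ZMod 2)
                (Fin.cons (fun _ => 1) (Fin.snoc R v : Fin (k + 1) → Bits h) :
                  Fin (k + 2) → Bits h) then
              some (Fin.snoc R v : Fin (k + 1) → Bits h)
            else none
        else PMF.pure none

/-- The matrix `[L | R]`. -/
def joinHalves {m h : ℕ} (L R : Fin m → Bits h) : Matrix (Fin m) (Fin (h + h)) (ZMod 2) :=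
  Matrix.of fun i => Fin.append (L i) (R i)

open Classical in
/-- The random construction: fill `L` with independent fair bits, halt (value `none`) if its
rows are linearly dependent, and otherwise build `R` row by row and output `[L | R]`. -/
noncomputable def construction (m h : ℕ) :
    PMF (Option (Matrix (Fin m) (Fin (h + h)) (ZMod 2))) :=
  (PMF.uniformOfFintype (Fin m → Bits h)).bind fun L =>
    if LinearIndependent (ZMod 2) L then
      (buildRight m L).map (Option.map (joinHalves L))
    else PMF.pure none

/-- The set of matrices that the construction outputs with positive probability. -/
def generated (m h : ℕ) : Set (Matrix (Fin m) (Fin (h + h)) (ZMod 2)) :=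
  {H | construction m h (some H) ≠ 0}

/-- The asymptotic count `2 ^ (n m - m² / 2 - m / 2)`. -/
noncomputable def countModel (m n : ℕ) : ℝ :=
  (2 : ℝ) ^ ((n : ℝ) * m - (m : ℝ) ^ 2 / 2 - (m : ℝ) / 2)

/-- Total variation distance between the law of the columns `S` of a uniformly random
dual-contained `m × n` matrix with independent rows, and the uniform law on
`m × |S|` binary matrices. -/
noncomputable def columnsTV (m n : ℕ) (S : Finset (Fin n)) : ℝ :=
  (1 / 2) * ∑ A : Matrix (Fin m) S (ZMod 2),
    |frac (dualContained m n) (fun H => H.submatrix id (fun j : S => (j : Fin n)) = A)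
      - 1 / 2 ^ (m * S.card)|

/-! ### CSS codes on `n` qubits -/

/-- State vectors of `n` qubits, written in the computational basis. -/
abbrev QState (n : ℕ) : Type := Bits n → ℂ

/-- The Pauli operator that applies `X` to the qubits in the support of `a`:
`|v⟩ ↦ |v + a⟩`. -/
def pauliX {n : ℕ} (a : Bits n) : QState n →ₗ[ℂ] QState n where
  toFun ψ := fun v => ψ (v + a)
  map_add' _ _ := rfl
  map_smul' _ _ := rfl

/-- The sign `(-1) ^ s` of a bit `s`. -/
def bitSign (s : ZMod 2) : ℂ := (-1) ^ s.val

/-- The Pauli operator that applies `Z` to the qubits in the support of `b`: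
`|v⟩ ↦ (-1) ^ (b ⬝ v) |v⟩`. -/
def pauliZ {n : ℕ} (b : Bits n) : QState n →ₗ[ℂ] QState n where
  toFun ψ := fun v => bitSign (b ⬝ᵥ v) * ψ v
  map_add' _ _ := by ext v; simp [mul_add]
  map_smul' _ _ := by ext v; simp [mul_left_comm]

/-- The CSS code with `X`-type stabilizer generators given by the rows of `HX` and `Z`-type
generators given by the rows of `HZ`: the joint `+1` eigenspace of the generators. -/
def cssCode {m m' n : ℕ} (HX : Matrix (Fin m) (Fin n) (ZMod 2))
    (HZ : Matrix (Fin m') (Fin n) (ZMod 2)) : Submodule ℂ (QState n) where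
  carrier := {ψ | (∀ i, pauliX (HX i) ψ = ψ) ∧ ∀ i, pauliZ (HZ i) ψ = ψ}
  add_mem' := by
    rintro a b ⟨h1, h2⟩ ⟨h3, h4⟩
    exact ⟨fun i => by rw [map_add, h1, h3], fun i => by rw [map_add, h2, h4]⟩
  zero_mem' := ⟨fun i => map_zero _, fun i => map_zero _⟩
  smul_mem' := by
    rintro c a ⟨h1, h2⟩
    exact ⟨fun i => by rw [map_smul, h1], fun i => by rw [map_smul, h2]⟩

/-- Measuring the stabilizer generators on `φ` gives with certainty the outcomes
`(-1) ^ (s i)` for the `Z`-type and `(-1) ^ (t i)` for the `X`-type generators. -/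
def HasSyndrome {m m' n : ℕ} (HX : Matrix (Fin m) (Fin n) (ZMod 2))
    (HZ : Matrix (Fin m') (Fin n) (ZMod 2)) (s : Bits m') (t : Bits m) (φ : QState n) : Prop :=
  (∀ i, pauliZ (HZ i) φ = bitSign (s i) • φ) ∧ ∀ i, pauliX (HX i) φ = bitSign (t i) • φ

/-- In the `X`-`Z` symmetric CSS code of `H`, the errors `X^x Z^z` are corrected by measuring
all stabilizer generators and applying the `X` operators that the decoder `D` assigns to the
outcomes of the `Z`-type generators and the `Z` operators that `D` assigns to the outcomes of
the `X`-type generators: every code state is restored up to a global phase. -/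
def CorrectsPauli {m n : ℕ} (H : Matrix (Fin m) (Fin n) (ZMod 2)) (D : Bits m → Bits n)
    (x z : Bits n) : Prop :=
  ∃ (s t : Bits m) (c : ℂ), ‖c‖ = 1 ∧ ∀ ψ ∈ cssCode H H,
    HasSyndrome H H s t (pauliX x (pauliZ z ψ)) ∧
      pauliX (D s) (pauliZ (D t) (pauliX x (pauliZ z ψ))) = c • ψ

/-- The error patterns of weight `w`. -/
def errorsOfWeight (n w : ℕ) : Finset (Bits n) :=
  Finset.univ.filter fun x => hammingNorm x = w

/-- With the decoder `D`, except with probability at most `η`,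
* the classical code with parity-check matrix `H` corrects a random error of weight `w`, for
  every `w ≤ p n`;
* the CSS code of `H` corrects a random pattern of `wx` `X` errors together with a random
  pattern of `wz` `Z` errors, for all `wx, wz ≤ p n`. -/
def CorrectsFraction {m n : ℕ} (H : Matrix (Fin m) (Fin n) (ZMod 2)) (D : Bits m → Bits n)
    (p η : ℝ) : Prop :=
  (∀ w : ℕ, (w : ℝ) ≤ p * n →
    1 - η ≤ frac (errorsOfWeight n w) (fun x => D (H *ᵥ x) = x)) ∧
  ∀ wx wz : ℕ, (wx : ℝ) ≤ p * n → (wz : ℝ) ≤ p * n →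
    1 - η ≤ frac (errorsOfWeight n wx ×ˢ errorsOfWeight n wz)
      (fun e => CorrectsPauli H D e.1 e.2)

/-- The binary entropy function, with logarithms to base two. -/
noncomputable def binaryEntropy (p : ℝ) : ℝ :=
  -p * Real.logb 2 p - (1 - p) * Real.logb 2 (1 - p)

/-- The number of rows `n / 2 - n ε`, rounded down. -/
noncomputable def numChecks (ε : ℝ) (n : ℕ) : ℕ := ⌊(n : ℝ) / 2 - n * ε⌋₊

/-!
Everything rests on counting isotropic families of vectors over the field with two elements by
adding one row at a time. A new row `v` must satisfy the linear conditions of orthogonality to the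
earlier rows and, since `v ⬝ v = 1 ⬝ v` in characteristic two, of orthogonality to the all-ones
vector. As long as the earlier rows are independent together with the all-ones vector, these
conditions are independent, and after `k` rows exactly `2 ^ (n - k - 1)` vectors satisfy them
(`numOf_solutions`). The product of these numbers is `countModel`.

* For dual-contained matrices, possibly annihilating one more vector `u`, the few families whose
  span meets `{0, 1, u, 1 + u}` in a nonzero vector break this count. Their weight obeys a
  recursion of its own and is `O(m 4 ^ m / 2 ^ n)`, which gives the number of dual-contained
  matrices and the collision probabilities (`abs_numOf_isotropic_sub_le`).
* For matrices split into two blocks of columns, `le_numOf_isGenerated` bounds from below the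
  number of those with independent rows in the left block and with the rows of the right block
  independent together with the all-ones vector. A bad new row has its left half in the span of
  the left block, or its right half in the span of the right block and the all-ones vector; given
  the left half, the conditions on the right half remain independent, and given the right half, so
  do the conditions of orthogonality to the earlier rows on the left half. For a fixed left block
  the number of right blocks is at most the model count (`numOf_isRightHalf_le`), so that an almost
  correct total forces an almost uniform left block (`columnsTV_le`).
* Each matrix that the construction can produce is produced with probability exactly
  `1 / countModel` (`toReal_construction_some`), so that the probability of halting is the relative
  defect of the preceding count (`toReal_construction_none`).
* For the codes, the decoder returns a pattern of weight at most `p n` with the given syndrome. It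
  fails on `x` only if some other pattern in the Hamming ball of radius `p n` has the syndrome of
  `x`. The ball has at most `2 ^ (n H₂(p))` points, and each collides with `x`
  with probability about `2 ^ (-m)`, so that the average ambiguity rate tends to zero exponentially
  fast (`tendsto_average_ambiguityRate`). Markov's inequality then gives almost every matrix, and an
  average element the sequence of codes. A CSS code corrects `X ^ x Z ^ z` as soon as the
  classical decoder recovers both `x` and `z` (`correctsPauli_of_decode`).
-/

/-! ### Counting over finite types -/

open Classical in
/-- The number of elements of a finite type that satisfy `P`, as a real number. -/
noncomputable def numOf {X : Type*} [Fintype X] (P : X → Prop) : ℝ :=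
  ((Finset.univ.filter P).card : ℝ)

section Counting

variable {X Y V : Type*} [Fintype X] [Fintype Y] [Fintype V]

theorem numOf_eq_sum (P : X → Prop) [DecidablePred P] :
    numOf P = ∑ x, if P x then (1 : ℝ) else 0 := by
  rw [numOf, Finset.sum_boole]
  congr!

theorem numOf_eq_one (a : X) : numOf (fun x => x = a) = 1 := by
  classical
  simp [numOf_eq_sum]

theorem numOf_nonneg (P : X → Prop) : 0 ≤ numOf P := Nat.cast_nonneg _

theorem numOf_mono {P Q : X → Prop} (h : ∀ x, P x → Q x) : numOf P ≤ numOf Q := by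
  classical
  exact Nat.cast_le.2 (Finset.card_le_card fun x hx => by
    simp only [Finset.mem_filter, Finset.mem_univ, true_and] at hx ⊢
    exact h x hx)

theorem numOf_congr {P Q : X → Prop} (h : ∀ x, P x ↔ Q x) : numOf P = numOf Q :=
  le_antisymm (numOf_mono fun x => (h x).1) (numOf_mono fun x => (h x).2)

theorem numOf_or_le (P Q : X → Prop) : numOf (fun x => P x ∨ Q x) ≤ numOf P + numOf Q := by
  classical
  simp only [numOf]
  rw [← Nat.cast_add, Nat.cast_le]
  refine le_trans (Finset.card_le_card fun x hx => ?_) (Finset.card_union_le _ _)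
  simpa using hx

theorem numOf_true : numOf (fun _ : X => True) = Fintype.card X := by
  classical
  simp [numOf]

theorem numOf_pos {P : X → Prop} (h : ∃ x, P x) : 0 < numOf P := by
  classical
  obtain ⟨x, hx⟩ := h
  exact Nat.cast_pos.2 (Finset.card_pos.2 ⟨x, by simpa using hx⟩)

theorem exists_of_numOf_pos {P : X → Prop} (h : 0 < numOf P) : ∃ x, P x := by
  classical
  obtain ⟨x, hx⟩ := Finset.card_pos.1 (Nat.cast_pos.1 h)
  exact ⟨x, by simpa using hx⟩

theorem numOf_equiv (e : X ≃ Y) (P : Y → Prop) : numOf (fun x => P (e x)) = numOf P := by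
  classical
  rw [numOf_eq_sum, numOf_eq_sum]
  exact Equiv.sum_comp e fun y => if P y then (1 : ℝ) else 0

theorem numOf_prod (P : X × Y → Prop) : numOf P = ∑ x, numOf fun y => P (x, y) := by
  classical
  simp only [numOf_eq_sum, Fintype.sum_prod_type]

/-- Counting along the fibres of a map. -/
theorem numOf_eq_sum_fiber (f : X → Y) (P : X → Prop) :
    numOf P = ∑ y, numOf fun x => f x = y ∧ P x := by
  classical
  simp only [numOf_eq_sum]
  rw [Finset.sum_comm]
  refine Finset.sum_congr rfl fun x _ => ?_
  rw [Finset.sum_eq_single (f x)] <;> simp +contextual [eq_comm]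

/-- If `P (x, y)` forces `Q x`, and each such `x` has at most `c` partners `y`, then at most
`c` times as many pairs satisfy `P` as elements satisfy `Q`. -/
theorem numOf_prod_le {P : X × Y → Prop} {Q : X → Prop} {c : ℝ}
    (hQ : ∀ x y, P (x, y) → Q x) (h : ∀ x, Q x → numOf (fun y => P (x, y)) ≤ c) :
    numOf P ≤ numOf Q * c := by
  classical
  rw [numOf_prod, numOf_eq_sum Q, Finset.sum_mul]
  refine Finset.sum_le_sum fun x _ => ?_
  by_cases hx : Q x
  · simpa [hx] using h x hx
  · have : numOf (fun y => P (x, y)) = 0 := by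
      simp only [numOf, Nat.cast_eq_zero, Finset.card_eq_zero]
      exact Finset.filter_eq_empty_iff.2 fun y _ hy => hx (hQ x y hy)
    simp [hx, this]

theorem le_numOf_prod {P : X × Y → Prop} {Q : X → Prop} {c : ℝ}
    (h : ∀ x, Q x → c ≤ numOf fun y => P (x, y)) : numOf Q * c ≤ numOf P := by
  classical
  rw [numOf_prod, numOf_eq_sum Q, Finset.sum_mul]
  refine Finset.sum_le_sum fun x _ => ?_
  by_cases hx : Q x
  · simpa [hx] using h x hx
  · simpa [hx] using numOf_nonneg _

theorem numOf_snoc {k : ℕ} (P : (Fin (k + 1) → V) → Prop) :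
    numOf P = numOf fun x : (Fin k → V) × V => P (Fin.snoc x.1 x.2) :=
  (numOf_equiv ((Equiv.prodComm _ _).trans (Fin.snocEquiv fun _ : Fin (k + 1) => V)) P).symm

theorem numOf_snoc_le {k : ℕ} {P : (Fin (k + 1) → V) → Prop} {Q : (Fin k → V) → Prop} {c : ℝ}
    (hQ : ∀ H v, P (Fin.snoc H v) → Q H)
    (h : ∀ H, Q H → numOf (fun v => P (Fin.snoc H v)) ≤ c) : numOf P ≤ numOf Q * c := by
  rw [numOf_snoc]
  exact numOf_prod_le hQ h

theorem le_numOf_snoc {k : ℕ} {P : (Fin (k + 1) → V) → Prop} {Q : (Fin k → V) → Prop} {c : ℝ}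
    (h : ∀ H, Q H → c ≤ numOf fun v => P (Fin.snoc H v)) : numOf Q * c ≤ numOf P := by
  rw [numOf_snoc]
  exact le_numOf_prod h

/-- The fibres of a surjective homomorphism of finite groups all have the same size. -/
theorem numOf_fiber [AddGroup X] [AddGroup Y] (f : X →+ Y) (hf : Function.Surjective f) (y : Y) :
    numOf (fun x => f x = y) = Fintype.card X / Fintype.card Y := by
  classical
  have h1 : ∀ z, numOf (fun x => f x = z) = numOf fun x => f x = y := fun z => by
    have h2 := AddMonoidHom.card_fiber_eq_of_mem_range f (hf z) (hf y)
    simp only [numOf]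
    convert congrArg (Nat.cast : ℕ → ℝ) h2
  have h3 := numOf_eq_sum_fiber f fun _ => True
  simp only [and_true, h1, numOf_true, Finset.sum_const, Finset.card_univ, nsmul_eq_mul] at h3
  have : (0 : ℝ) < Fintype.card Y := Nat.cast_pos.2 Fintype.card_pos
  field_simp
  linarith

end Counting

/-! ### Linear systems over the field with two elements -/

theorem dotProduct_self_eq {ι : Type*} [Fintype ι] (v : ι → ZMod 2) :
    v ⬝ᵥ v = (fun _ => 1) ⬝ᵥ v := by
  simp only [dotProduct, one_mul]
  refine Finset.sum_congr rfl fun i _ => ?_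
  generalize v i = a
  revert a
  decide

section Systems

variable {ι κ : Type*} [Fintype ι] [DecidableEq ι] [Fintype κ]

/-- A linear system with independent rows `f` has `2 ^ (n - |κ|)` solutions for every right-hand
side. -/
theorem numOf_solutions {f : κ → ι → ZMod 2} (hf : LinearIndependent (ZMod 2) f)
    (c : κ → ZMod 2) :
    numOf (fun v : ι → ZMod 2 => ∀ i, f i ⬝ᵥ v = c i)
      = 2 ^ Fintype.card ι / 2 ^ Fintype.card κ := by
  classical
  have hs : Function.Surjective (Matrix.mulVecLin (Matrix.of f)) := by
    rw [← LinearMap.range_eq_top]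
    apply Submodule.eq_top_of_finrank_eq
    have h := LinearIndependent.rank_matrix (M := Matrix.of f) hf
    simpa [Matrix.rank] using h
  have h := numOf_fiber (Matrix.mulVecLin (Matrix.of f)).toAddMonoidHom hs c
  simp only [Fintype.card_fun, ZMod.card, Nat.cast_pow, Nat.cast_ofNat] at h
  rw [← h]
  refine numOf_congr fun v => ?_
  simp only [LinearMap.toAddMonoidHom_coe, Matrix.mulVecLin_apply, funext_iff]
  rfl

theorem numOf_mem_span_le (f : κ → ι → ZMod 2) :
    numOf (fun v : ι → ZMod 2 => v ∈ Submodule.span (ZMod 2) (Set.range f))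
      ≤ 2 ^ Fintype.card κ := by
  classical
  have h : Finset.univ.filter (fun v : ι → ZMod 2 =>
      v ∈ Submodule.span (ZMod 2) (Set.range f)) ⊆
      Finset.univ.image fun c : κ → ZMod 2 => ∑ i, c i • f i := by
    intro v hv
    simp only [Finset.mem_filter, Finset.mem_univ, true_and, Finset.mem_image] at hv ⊢
    exact (Submodule.mem_span_range_iff_exists_fun (ZMod 2)).1 hv
  have h2 := (Finset.card_le_card h).trans Finset.card_image_le
  simp only [Finset.card_univ, Fintype.card_fun, ZMod.card] at h2
  unfold numOf
  exact_mod_cast h2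

end Systems

/-! ### Dual-contained matrices orthogonal to prescribed vectors -/

section Constrained

variable {n w : ℕ}

/-- The rows of `H` are orthogonal to themselves, to each other and to the vectors `W`. -/
def IsotropicTo (W : Fin w → Bits n) {k : ℕ} (H : Fin k → Bits n) : Prop :=
  (∀ i j, H i ⬝ᵥ H j = 0) ∧ ∀ l i, W l ⬝ᵥ H i = 0

/-- As the all-ones vector is among `W`, a new row is orthogonal to itself once it is orthogonal
to `W`, so that only linear conditions remain. -/
theorem isotropicTo_snoc {W : Fin w → Bits n} (hW : ∃ l, W l = fun _ => 1) {k : ℕ}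
    (H : Fin k → Bits n) (v : Bits n) :
    IsotropicTo W (Fin.snoc H v : Fin (k + 1) → Bits n) ↔
      IsotropicTo W H ∧ ∀ i, (Fin.append W H) i ⬝ᵥ v = 0 := by
  simp only [IsotropicTo, Fin.forall_fin_succ', Fin.snoc_castSucc, Fin.snoc_last,
    Fin.forall_fin_add, Fin.append_left, Fin.append_right, forall_and]
  obtain ⟨l, hl⟩ := hW
  constructor
  · rintro ⟨⟨⟨h1, -⟩, h2, -⟩, h5, h6⟩
    exact ⟨⟨h1, h5⟩, h6, h2⟩
  · rintro ⟨⟨h1, h5⟩, h6, h2⟩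
    refine ⟨⟨⟨h1, fun i => by rw [dotProduct_comm]; exact h2 i⟩, h2, ?_⟩, h5, h6⟩
    rw [dotProduct_self_eq, ← hl]
    exact h6 l

/-- The number of isotropic families of `m` vectors orthogonal to `w` given vectors, if each new
vector is subject to independent linear conditions. -/
noncomputable def isotropicModel (w n m : ℕ) : ℝ := ∏ k ∈ Finset.range m, (2 ^ n / 2 ^ (w + k) : ℝ)

theorem isotropicModel_pos (w n m : ℕ) : 0 < isotropicModel w n m :=
  Finset.prod_pos fun _ _ => by positivity

theorem isotropicModel_succ (w n m : ℕ) :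
    isotropicModel w n (m + 1) = isotropicModel w n m * (2 ^ n / 2 ^ (w + m)) :=
  Finset.prod_range_succ _ _

/-- Isotropic families that are independent together with `W`. -/
def IsTransverse (W : Fin w → Bits n) {k : ℕ} (H : Fin k → Bits n) : Prop :=
  IsotropicTo W H ∧ LinearIndependent (ZMod 2) (Fin.append W H)

/-- Independent isotropic families that are dependent together with `W`; for independent `W`, the
two spans then share a nonzero vector. -/
def IsExceptional (W : Fin w → Bits n) {k : ℕ} (H : Fin k → Bits n) : Prop :=
  IsotropicTo W H ∧ LinearIndependent (ZMod 2) H ∧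
    ¬ LinearIndependent (ZMod 2) (Fin.append W H)

theorem isTransverse_snoc {W : Fin w → Bits n} (hW : ∃ l, W l = fun _ => 1) {k : ℕ}
    (H : Fin k → Bits n) (v : Bits n) :
    IsTransverse W (Fin.snoc H v : Fin (k + 1) → Bits n) ↔
      IsTransverse W H ∧ (∀ i, (Fin.append W H) i ⬝ᵥ v = 0) ∧
        v ∉ Submodule.span (ZMod 2) (Set.range (Fin.append W H)) := by
  rw [IsTransverse, isotropicTo_snoc hW, Fin.append_snoc]
  have := linearIndependent_finSnoc (K := ZMod 2) (v := Fin.append W H) (x := v)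
  rw [IsTransverse]
  constructor
  · rintro ⟨⟨h1, h2⟩, h3⟩
    exact ⟨⟨h1, (this.1 h3).1⟩, h2, (this.1 h3).2⟩
  · rintro ⟨⟨h1, h2⟩, h3, h4⟩
    exact ⟨⟨h1, h3⟩, this.2 ⟨h2, h4⟩⟩

theorem numOf_isTransverse_le {W : Fin w → Bits n} (hW : ∃ l, W l = fun _ => 1) (m : ℕ) :
    numOf (IsTransverse W (k := m)) ≤ isotropicModel w n m := by
  induction m with
  | zero =>
    refine (numOf_mono fun _ _ => trivial).trans_eq (numOf_true.trans ?_)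
    simp [isotropicModel]
  | succ m ih =>
    rw [isotropicModel_succ]
    refine (numOf_snoc_le (Q := IsTransverse W) (fun H v h => ((isTransverse_snoc hW H v).1 h).1)
      fun H hH => ?_).trans (mul_le_mul_of_nonneg_right ih (by positivity))
    refine (numOf_mono fun v h => ((isTransverse_snoc hW H v).1 h).2.1).trans_eq ?_
    simpa using numOf_solutions hH.2 (fun _ => 0)

theorem mul_le_numOf_isTransverse_succ {W : Fin w → Bits n} (hW : ∃ l, W l = fun _ => 1) (m : ℕ) :
    numOf (IsTransverse W (k := m)) * (2 ^ n / 2 ^ (w + m) - 2 ^ (w + m))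
      ≤ numOf (IsTransverse W (k := m + 1)) := by
  refine le_numOf_snoc fun H hH => ?_
  have h1 := numOf_solutions hH.2 (fun _ => 0)
  have h2 := numOf_mem_span_le (Fin.append W H)
  simp only [Fintype.card_fin] at h1 h2
  rw [← h1, sub_le_iff_le_add]
  refine le_trans ?_ (add_le_add_right h2 _)
  refine le_trans (numOf_mono fun v hv => ?_) (numOf_or_le _ _)
  rw [isTransverse_snoc hW]
  by_cases h : v ∈ Submodule.span (ZMod 2) (Set.range (Fin.append W H))
  · exact Or.inr h
  · exact Or.inl ⟨hH, hv, h⟩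

theorem two_pow_eq_mul (w n k : ℕ) :
    (2 : ℝ) ^ (w + k) = 2 ^ n / 2 ^ (w + k) * (4 ^ w * 4 ^ k / 2 ^ n) := by
  have h : (4 : ℝ) ^ w * 4 ^ k = 2 ^ (w + k) * 2 ^ (w + k) := by
    rw [← pow_add, ← mul_pow]; norm_num
  rw [h]
  field_simp

theorem four_pow_le {w : ℕ} (hw : w ≤ 2) : (4 : ℝ) ^ w ≤ 16 :=
  (pow_le_pow_right₀ (by norm_num) hw).trans_eq (by norm_num)

theorem le_numOf_isTransverse (hw : w ≤ 2) {W : Fin w → Bits n} (hW : ∃ l, W l = fun _ => 1)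
    (hi : LinearIndependent (ZMod 2) W) (m : ℕ) :
    isotropicModel w n m * (1 - 16 * 4 ^ m / 2 ^ n) ≤ numOf (IsTransverse W (k := m)) := by
  induction m with
  | zero =>
    have : 1 ≤ numOf (IsTransverse W (k := 0)) := by
      rw [show (1 : ℝ) = numOf fun _ : Fin 0 → Bits n => True by rw [numOf_true]; simp]
      refine numOf_mono fun H _ => ⟨⟨fun i => i.elim0, fun _ i => i.elim0⟩, ?_⟩
      have : Fin.append W H = W := by rw [Fin.append_right_nil _ _ rfl]; rfl
      rw [this]
      exact hi
    refine le_trans ?_ this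
    have : (0 : ℝ) ≤ 16 * 4 ^ 0 / 2 ^ n := by positivity
    simp only [isotropicModel, Finset.range_zero, Finset.prod_empty]
    linarith
  | succ m ih =>
    set x : ℝ := 16 * 4 ^ m / 2 ^ n with hx
    have hx0 : 0 ≤ x := by positivity
    have hx4 : (16 * 4 ^ (m + 1) / 2 ^ n : ℝ) = 4 * x := by rw [hx, pow_succ]; ring
    rw [hx4]
    -- For `x ≥ 1` the lower bound is negative.
    rcases lt_or_ge x 1 with h1 | h1
    · refine le_trans ?_ (mul_le_numOf_isTransverse_succ hW m)
      have hc : (2 : ℝ) ^ n / 2 ^ (w + m) * (1 - x) ≤ 2 ^ n / 2 ^ (w + m) - 2 ^ (w + m) := by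
        have h2 := two_pow_eq_mul w n m
        have h3 : (4 ^ w * 4 ^ m / 2 ^ n : ℝ) ≤ x := by
          rw [hx]
          have := four_pow_le hw
          gcongr
        have h4 := mul_le_mul_of_nonneg_left h3
          (show (0 : ℝ) ≤ 2 ^ n / 2 ^ (w + m) by positivity)
        rw [← h2] at h4
        linarith
      refine le_trans ?_ (mul_le_mul ih hc (mul_nonneg (by positivity) (by linarith))
        (numOf_nonneg _))
      rw [isotropicModel_succ]
      have hp : 0 ≤ isotropicModel w n m * (2 ^ n / 2 ^ (w + m)) :=
        mul_nonneg (isotropicModel_pos _ _ _).le (by positivity)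
      nlinarith [mul_nonneg hp hx0, mul_nonneg hp (mul_nonneg hx0 hx0)]
    · refine le_trans ?_ (numOf_nonneg _)
      exact mul_nonpos_of_nonneg_of_nonpos (isotropicModel_pos _ _ _).le (by linarith)

/-- An exceptional family of `m + 1` vectors either extends a transverse one by a vector of its span
with `W`, with few choices, or extends an exceptional one, where the conditions of `W` are dropped
and `2 ^ w ≤ 4` times as many choices remain as in the model. -/
theorem numOf_isExceptional_le (hw : w ≤ 2) {W : Fin w → Bits n} (hW : ∃ l, W l = fun _ => 1)
    (hi : LinearIndependent (ZMod 2) W) (m : ℕ) :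
    numOf (IsExceptional W (k := m)) ≤ isotropicModel w n m * (m * (16 * 4 ^ m / 2 ^ n)) := by
  induction m with
  | zero =>
    simp only [Nat.cast_zero, zero_mul, mul_zero]
    by_contra! h
    obtain ⟨H, hH⟩ := exists_of_numOf_pos h
    refine hH.2.2 ?_
    have : Fin.append W H = W := by rw [Fin.append_right_nil _ _ rfl]; rfl
    rw [this]
    exact hi
  | succ m ih =>
    have key : numOf (IsExceptional W (k := m + 1)) ≤
        numOf (IsTransverse W (k := m)) * 2 ^ (w + m)
          + numOf (IsExceptional W (k := m)) * (2 ^ n / 2 ^ m) := by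
      have hs : ∀ (H : Fin m → Bits n) (v : Bits n), IsExceptional W (Fin.snoc H v) →
          IsotropicTo W H ∧ LinearIndependent (ZMod 2) H ∧
            (∀ i, (Fin.append W H) i ⬝ᵥ v = 0) ∧
            (LinearIndependent (ZMod 2) (Fin.append W H) →
              v ∈ Submodule.span (ZMod 2) (Set.range (Fin.append W H))) := by
        rintro H v ⟨h1, h2, h3⟩
        rw [isotropicTo_snoc hW] at h1
        have h4 := linearIndependent_finSnoc.1 h2
        refine ⟨h1.1, h4.1, h1.2, fun h5 => ?_⟩
        by_contra h6
        exact h3 (by rw [Fin.append_snoc]; exact linearIndependent_finSnoc.2 ⟨h5, h6⟩)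
      refine le_trans (numOf_mono fun H hH => ?_) ((numOf_or_le
        (fun H => IsExceptional W H ∧ IsTransverse W (Fin.init H))
        (fun H => IsExceptional W H ∧ IsExceptional W (Fin.init H))).trans (add_le_add ?_ ?_))
      · have h := hs (Fin.init H) (H (Fin.last m)) (by rwa [Fin.snoc_init_self])
        by_cases h5 : LinearIndependent (ZMod 2) (Fin.append W (Fin.init H))
        · exact Or.inl ⟨hH, h.1, h5⟩
        · exact Or.inr ⟨hH, h.1, h.2.1, h5⟩
      · refine numOf_snoc_le (fun H v h => by simpa using h.2) fun H hH => ?_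
        refine (numOf_mono fun v hv => (hs H v hv.1).2.2.2 hH.2).trans ?_
        simpa using numOf_mem_span_le (Fin.append W H)
      · refine numOf_snoc_le (fun H v h => by simpa using h.2) fun H hH => ?_
        refine (numOf_mono (Q := fun v => ∀ i, H i ⬝ᵥ v = 0) fun v hv i => ?_).trans_eq ?_
        · simpa using (hs H v hv.1).2.2.1 (Fin.natAdd w i)
        · simpa using numOf_solutions hH.2.1 (fun _ => 0)
    refine key.trans ((add_le_add (mul_le_mul_of_nonneg_right (numOf_isTransverse_le hW m)
      (by positivity)) (mul_le_mul_of_nonneg_right ih (by positivity))).trans ?_)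
    rw [two_pow_eq_mul w n m, isotropicModel_succ]
    have hM := isotropicModel_pos w n m
    have e : (2 : ℝ) ^ n / 2 ^ m = 2 ^ n / 2 ^ (w + m) * 2 ^ w := by
      rw [pow_add]; field_simp
    rw [e]
    have hc : (0 : ℝ) < 2 ^ n / 2 ^ (w + m) := by positivity
    set c : ℝ := 2 ^ n / 2 ^ (w + m)
    have h4 := four_pow_le hw
    have h2 : (2 : ℝ) ^ w ≤ 4 := (pow_le_pow_right₀ (by norm_num) hw).trans_eq (by norm_num)
    set y : ℝ := 4 ^ m / 2 ^ n with hy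
    have hy0 : 0 ≤ y := by positivity
    have e1 : (4 ^ w * 4 ^ m / 2 ^ n : ℝ) = 4 ^ w * y := by rw [hy]; ring
    have e2 : (16 * 4 ^ (m + 1) / 2 ^ n : ℝ) = 64 * y := by rw [hy, pow_succ]; ring
    have e3 : (16 * 4 ^ m / 2 ^ n : ℝ) = 16 * y := by rw [hy]; ring
    rw [e1, e2, e3]
    have hm : (0 : ℝ) ≤ m := Nat.cast_nonneg m
    push_cast
    have a1 : (4 : ℝ) ^ w * y ≤ 16 * y := mul_le_mul_of_nonneg_right h4 hy0
    have a2 : (m : ℝ) * (16 * y) * 2 ^ w ≤ m * (16 * y) * 4 :=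
      mul_le_mul_of_nonneg_left h2 (by positivity)
    have a3 : (4 : ℝ) ^ w * y + m * (16 * y) * 2 ^ w ≤ (m + 1) * (64 * y) := by nlinarith
    have a4 := mul_le_mul_of_nonneg_left a3 (mul_nonneg hM.le hc.le)
    linarith

/-- If `W` consists of at most two independent vectors, among them the all-ones vector, then the
number of independent isotropic families orthogonal to `W` is close to the model count. -/
theorem abs_numOf_isotropic_sub_le (hw : w ≤ 2) {W : Fin w → Bits n} (hW : ∃ l, W l = fun _ => 1)
    (hi : LinearIndependent (ZMod 2) W) (m : ℕ) :
    |numOf (fun H : Fin m → Bits n => IsotropicTo W H ∧ LinearIndependent (ZMod 2) H)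
        / isotropicModel w n m - 1| ≤ 16 * (m + 1) * (4 ^ m / 2 ^ n) := by
  have hM := isotropicModel_pos w n m
  have hy : (0 : ℝ) ≤ 4 ^ m / 2 ^ n := by positivity
  have hm : (0 : ℝ) ≤ m := Nat.cast_nonneg m
  have hlow : numOf (IsTransverse W (k := m)) ≤
      numOf fun H : Fin m → Bits n => IsotropicTo W H ∧ LinearIndependent (ZMod 2) H :=
    numOf_mono fun H h => ⟨h.1, by
      have := h.2.comp (Fin.natAdd w) (Fin.natAdd_injective m w)
      convert this using 1
      ext i
      simp⟩
  have hup : (numOf fun H : Fin m → Bits n => IsotropicTo W H ∧ LinearIndependent (ZMod 2) H) ≤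
      numOf (IsTransverse W (k := m)) + numOf (IsExceptional W (k := m)) := by
    refine (numOf_mono fun H hH => ?_).trans (numOf_or_le _ _)
    by_cases h : LinearIndependent (ZMod 2) (Fin.append W H)
    · exact Or.inl ⟨hH.1, h⟩
    · exact Or.inr ⟨hH.1, hH.2, h⟩
  have h1 := numOf_isTransverse_le hW m
  have h2 := le_numOf_isTransverse hw hW hi m
  have h3 := numOf_isExceptional_le hw hW hi m
  have e3 : (16 * 4 ^ m / 2 ^ n : ℝ) = 16 * (4 ^ m / 2 ^ n) := by ring
  rw [e3] at h2 h3
  rw [abs_le]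
  constructor
  · rw [le_sub_iff_add_le, le_div_iff₀ hM]
    nlinarith [mul_nonneg hM.le (mul_nonneg hm hy)]
  · rw [sub_le_iff_le_add, div_le_iff₀ hM]
    nlinarith [mul_nonneg hM.le hy]

end Constrained

/-! ### Dual-contained matrices split into two blocks of columns -/

theorem countModel_eq (m n : ℕ) : countModel m n = isotropicModel 1 n m := by
  induction m with
  | zero => simp [countModel, isotropicModel]
  | succ m ih =>
    rw [isotropicModel_succ, ← ih]
    have h : (2 : ℝ) ^ n / 2 ^ (1 + m) = (2 : ℝ) ^ ((n : ℝ) - (1 + m)) := by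
      rw [Real.rpow_sub two_pos, Real.rpow_natCast]
      congr 1
      rw [← Real.rpow_natCast]
      push_cast
      rfl
    rw [h, countModel, countModel, ← Real.rpow_add two_pos]
    congr 1
    push_cast
    ring

theorem isotropicModel_add (w s t m : ℕ) :
    isotropicModel w (s + t) m = (2 ^ s) ^ m * isotropicModel w t m := by
  induction m with
  | zero => simp [isotropicModel]
  | succ m ih =>
    rw [isotropicModel_succ, isotropicModel_succ, ih, pow_succ, pow_add]
    ring

section Halves

variable {α β : Type*} [Fintype α] [DecidableEq α] [Fintype β] [DecidableEq β]

/-- `[L | R]` has pairwise and self-orthogonal rows, and the rows of `R` are independent together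
with the all-ones vector. -/
def IsRightHalf {k : ℕ} (L : Fin k → α → ZMod 2) (R : Fin k → β → ZMod 2) : Prop :=
  LinearIndependent (ZMod 2) (Fin.cons (fun _ => 1) R : Fin (k + 1) → β → ZMod 2) ∧
    ∀ i j, L i ⬝ᵥ L j + R i ⬝ᵥ R j = 0

/-- The condition on a new row `v` of the right block, when the products of the new left row with
the earlier left rows are `c`, and its product with itself is `d`. -/
def IsNext {k : ℕ} (c : Fin k → ZMod 2) (d : ZMod 2) (R : Fin k → β → ZMod 2)
    (v : β → ZMod 2) : Prop :=
  (∀ j, c j + v ⬝ᵥ R j = 0) ∧ d + v ⬝ᵥ v = 0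

omit [DecidableEq α] [DecidableEq β] in
theorem isRightHalf_snoc {k : ℕ} (L : Fin (k + 1) → α → ZMod 2) (R : Fin k → β → ZMod 2)
    (v : β → ZMod 2) :
    IsRightHalf L (Fin.snoc R v : Fin (k + 1) → β → ZMod 2) ↔
      IsRightHalf (Fin.init L) R ∧
        IsNext (fun j => L (Fin.last k) ⬝ᵥ L j.castSucc) (L (Fin.last k) ⬝ᵥ L (Fin.last k)) R v ∧
        v ∉ Submodule.span (ZMod 2)
          (Set.range (Fin.cons (fun _ => 1) R : Fin (k + 1) → β → ZMod 2)) := by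
  simp only [IsRightHalf, IsNext, Fin.cons_snoc_eq_snoc_cons, Fin.init]
  rw [linearIndependent_finSnoc]
  simp only [Fin.forall_fin_succ', Fin.snoc_castSucc, Fin.snoc_last, forall_and]
  constructor
  · rintro ⟨⟨h1, h2⟩, ⟨h3, h4⟩, h5, h6⟩
    refine ⟨⟨h1, h3⟩, ⟨?_, h6⟩, h2⟩
    intro j
    first | exact h5 j | exact h4 j
  · rintro ⟨⟨h1, h3⟩, ⟨h5, h6⟩, h2⟩
    refine ⟨⟨h1, h2⟩, ⟨h3, ?_⟩, ?_, h6⟩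
    · intro j
      exact h5 j
    · intro j
      rw [dotProduct_comm, dotProduct_comm (R j)]
      exact h5 j

omit [DecidableEq β] in
/-- The conditions on a new right row, the quadratic one included, form a linear system with rows
`1, R 0, …, R (k - 1)`. -/
theorem isNext_iff {k : ℕ} (c : Fin k → ZMod 2) (d : ZMod 2) (R : Fin k → β → ZMod 2)
    (v : β → ZMod 2) :
    IsNext c d R v ↔ ∀ i, (Fin.cons (fun _ => 1) R : Fin (k + 1) → β → ZMod 2) i ⬝ᵥ v
      = (Fin.cons d c : Fin (k + 1) → ZMod 2) i := by
  rw [Fin.forall_fin_succ, IsNext, and_comm]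
  simp only [Fin.cons_zero, Fin.cons_succ, ← dotProduct_self_eq, CharTwo.add_eq_zero,
    dotProduct_comm v]
  simp only [eq_comm]

theorem numOf_isNext {k : ℕ} {R : Fin k → β → ZMod 2}
    (hR : LinearIndependent (ZMod 2) (Fin.cons (fun _ => 1) R : Fin (k + 1) → β → ZMod 2))
    (c : Fin k → ZMod 2) (d : ZMod 2) :
    numOf (IsNext c d R) = 2 ^ Fintype.card β / 2 ^ (1 + k) := by
  rw [numOf_congr (isNext_iff c d R), numOf_solutions hR, Fintype.card_fin, add_comm]

omit [DecidableEq α] in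
theorem numOf_isRightHalf_le {m : ℕ} (L : Fin m → α → ZMod 2) :
    numOf (IsRightHalf (β := β) L) ≤ isotropicModel 1 (Fintype.card β) m := by
  induction m with
  | zero =>
    refine (numOf_mono fun _ _ => trivial).trans_eq (numOf_true.trans ?_)
    simp [isotropicModel]
  | succ m ih =>
    rw [isotropicModel_succ]
    refine (numOf_snoc_le (Q := IsRightHalf (Fin.init L))
      (fun R v h => ((isRightHalf_snoc L R v).1 h).1)
      fun R hR => ?_).trans (mul_le_mul_of_nonneg_right (ih _) (by positivity))
    refine (numOf_mono fun v h => ((isRightHalf_snoc L R v).1 h).2.1).trans_eq ?_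
    exact numOf_isNext hR.1 _ _

/-- Matrices `[L | R]` that the row-by-row construction can produce: isotropic, with independent
rows in `L`, and with the rows of `R` independent together with the all-ones vector. -/
def IsGenerated {k : ℕ} (H : Fin k → (α → ZMod 2) × (β → ZMod 2)) : Prop :=
  LinearIndependent (ZMod 2) (fun i => (H i).1) ∧
    IsRightHalf (fun i => (H i).1) fun i => (H i).2

omit [DecidableEq α] [DecidableEq β] in
theorem isGenerated_snoc {k : ℕ} (H : Fin k → (α → ZMod 2) × (β → ZMod 2))
    (v : (α → ZMod 2) × (β → ZMod 2)) :
    IsGenerated (Fin.snoc H v : Fin (k + 1) → (α → ZMod 2) × (β → ZMod 2)) ↔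
      IsGenerated H ∧
        IsNext (fun j => v.1 ⬝ᵥ (H j).1) (v.1 ⬝ᵥ v.1) (fun i => (H i).2) v.2 ∧
        v.1 ∉ Submodule.span (ZMod 2) (Set.range fun i => (H i).1) ∧
        v.2 ∉ Submodule.span (ZMod 2)
          (Set.range (Fin.cons (fun _ => 1) fun i => (H i).2 : Fin (k + 1) → β → ZMod 2)) := by
  have e1 : (fun i => ((Fin.snoc H v : Fin (k + 1) → (α → ZMod 2) × (β → ZMod 2)) i).1)
      = Fin.snoc (fun i => (H i).1) v.1 := Fin.comp_snoc Prod.fst H v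
  have e2 : (fun i => ((Fin.snoc H v : Fin (k + 1) → (α → ZMod 2) × (β → ZMod 2)) i).2)
      = Fin.snoc (fun i => (H i).2) v.2 := Fin.comp_snoc Prod.snd H v
  simp only [IsGenerated]
  rw [e1, e2, isRightHalf_snoc, linearIndependent_finSnoc]
  simp only [Fin.init_snoc, Fin.snoc_last, Fin.snoc_castSucc]
  tauto

/-- The row `v = [a | b]` is orthogonal to itself and to the rows of `H`. -/
def IsNextRow {k : ℕ} (H : Fin k → (α → ZMod 2) × (β → ZMod 2))
    (v : (α → ZMod 2) × (β → ZMod 2)) : Prop :=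
  IsNext (fun j => v.1 ⬝ᵥ (H j).1) (v.1 ⬝ᵥ v.1) (fun i => (H i).2) v.2

omit [DecidableEq α] in
theorem numOf_isNextRow_right {k : ℕ} {H : Fin k → (α → ZMod 2) × (β → ZMod 2)}
    (hH : IsGenerated H) (a : α → ZMod 2) :
    numOf (fun b => IsNextRow H (a, b)) = 2 ^ Fintype.card β / 2 ^ (1 + k) :=
by
  have h := numOf_isNext hH.2.1 (fun j => a ⬝ᵥ (H j).1) (a ⬝ᵥ a)
  exact h

theorem le_numOf_isNextRow {k : ℕ} {H : Fin k → (α → ZMod 2) × (β → ZMod 2)}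
    (hH : IsGenerated H) :
    2 ^ Fintype.card α * (2 ^ Fintype.card β / 2 ^ (1 + k)) ≤ numOf (IsNextRow H) := by
  have h := le_numOf_prod (P := IsNextRow H) (Q := fun _ => True)
    (c := 2 ^ Fintype.card β / 2 ^ (1 + k)) fun a _ => (numOf_isNextRow_right hH a).ge
  rw [numOf_true, Fintype.card_fun, ZMod.card] at h
  exact_mod_cast h

theorem numOf_isNextRow_left_dependent_le {k : ℕ} {H : Fin k → (α → ZMod 2) × (β → ZMod 2)}
    (hH : IsGenerated H) :
    numOf (fun v => IsNextRow H v ∧ v.1 ∈ Submodule.span (ZMod 2) (Set.range fun i => (H i).1))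
      ≤ 2 ^ k * (2 ^ Fintype.card β / 2 ^ (1 + k)) := by
  have h1 := numOf_mem_span_le fun i => (H i).1
  rw [Fintype.card_fin] at h1
  refine (numOf_prod_le (Q := fun a => a ∈ Submodule.span (ZMod 2) (Set.range fun i => (H i).1))
    (fun a b h => h.2) fun a _ => ?_).trans (mul_le_mul_of_nonneg_right h1 (by positivity))
  exact (numOf_mono fun b h => h.1).trans_eq (numOf_isNextRow_right hH a)

/-- For a prescribed right half `b`, the orthogonality conditions are a linear system for the left
half with the independent rows of the left block. -/
theorem numOf_isNextRow_right_dependent_le {k : ℕ} {H : Fin k → (α → ZMod 2) × (β → ZMod 2)}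
    (hH : IsGenerated H) :
    numOf (fun v => IsNextRow H v ∧ v.2 ∈ Submodule.span (ZMod 2)
      (Set.range (Fin.cons (fun _ => 1) fun i => (H i).2 : Fin (k + 1) → β → ZMod 2)))
      ≤ 2 ^ (k + 1) * (2 ^ Fintype.card α / 2 ^ k) := by
  have h1 := numOf_mem_span_le
    (Fin.cons (fun _ => 1) fun i => (H i).2 : Fin (k + 1) → β → ZMod 2)
  rw [Fintype.card_fin] at h1
  rw [← numOf_equiv (Equiv.prodComm (β → ZMod 2) (α → ZMod 2))]
  refine (numOf_prod_le (Q := fun b => b ∈ Submodule.span (ZMod 2)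
      (Set.range (Fin.cons (fun _ => 1) fun i => (H i).2 : Fin (k + 1) → β → ZMod 2)))
    (fun b a h => h.2) fun b _ => ?_).trans (mul_le_mul_of_nonneg_right h1 (by positivity))
  refine (numOf_mono (Q := fun a => ∀ j, (H j).1 ⬝ᵥ a = b ⬝ᵥ (H j).2) fun a h j => ?_).trans_eq ?_
  · have h2 : a ⬝ᵥ (H j).1 + b ⬝ᵥ (H j).2 = 0 := h.1.1 j
    rw [CharTwo.add_eq_zero] at h2
    rw [dotProduct_comm]
    exact h2
  · rw [numOf_solutions hH.1, Fintype.card_fin]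

theorem numOf_isNextRow_le {k : ℕ} {H : Fin k → (α → ZMod 2) × (β → ZMod 2)}
    (hH : IsGenerated H) :
    numOf (IsNextRow H) ≤ numOf (fun v => IsGenerated (Fin.snoc H v :
      Fin (k + 1) → (α → ZMod 2) × (β → ZMod 2))) +
      (2 ^ k * (2 ^ Fintype.card β / 2 ^ (1 + k)) +
        2 ^ (k + 1) * (2 ^ Fintype.card α / 2 ^ k)) := by
  refine le_trans ?_ (add_le_add_right (add_le_add (numOf_isNextRow_left_dependent_le hH)
    (numOf_isNextRow_right_dependent_le hH)) _)
  refine (numOf_mono fun v hv => ?_).trans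
    ((numOf_or_le _ _).trans (add_le_add_right (numOf_or_le _ _) _))
  by_cases h1 : v.1 ∈ Submodule.span (ZMod 2) (Set.range fun i => (H i).1)
  · exact Or.inr (Or.inl ⟨hv, h1⟩)
  · by_cases h2 : v.2 ∈ Submodule.span (ZMod 2)
      (Set.range (Fin.cons (fun _ => 1) fun i => (H i).2 : Fin (k + 1) → β → ZMod 2))
    · exact Or.inr (Or.inr ⟨hv, h2⟩)
    · exact Or.inl ((isGenerated_snoc H v).2 ⟨hH, hv, h1, h2⟩)

theorem mul_le_numOf_isGenerated_succ (k : ℕ) :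
    numOf (IsGenerated (α := α) (β := β) (k := k)) *
        (2 ^ (Fintype.card α + Fintype.card β) / 2 ^ (1 + k) *
          (1 - 4 * 2 ^ k / 2 ^ Fintype.card β - 2 ^ k / 2 ^ Fintype.card α))
      ≤ numOf (IsGenerated (α := α) (β := β) (k := k + 1)) := by
  refine le_numOf_snoc fun H hH => ?_
  have h1 := le_numOf_isNextRow hH
  have h2 := numOf_isNextRow_le hH
  generalize Fintype.card α = s at *
  generalize Fintype.card β = t at *
  have e : (2 : ℝ) ^ (s + t) / 2 ^ (1 + k) * (1 - 4 * 2 ^ k / 2 ^ t - 2 ^ k / 2 ^ s)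
      = 2 ^ s * (2 ^ t / 2 ^ (1 + k)) - 2 ^ (k + 1) * (2 ^ s / 2 ^ k)
        - 2 ^ k * (2 ^ t / 2 ^ (1 + k)) := by
    rw [add_comm 1 k, pow_add, pow_succ]
    field_simp
    ring
  rw [e]
  linarith

/-- Lower bound for the number of producible matrices. The loss doubles in each step, so that the
losses of all steps add up to a multiple of the last one. -/
theorem le_numOf_isGenerated (m : ℕ) :
    isotropicModel 1 (Fintype.card α + Fintype.card β) m *
        (1 - 4 * 2 ^ m / 2 ^ Fintype.card β - 2 ^ m / 2 ^ Fintype.card α)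
      ≤ numOf (IsGenerated (α := α) (β := β) (k := m)) := by
  induction m with
  | zero =>
    -- If the right block has no columns, the lower bound is not positive.
    by_cases hβ : Nonempty β
    · have : 1 ≤ numOf (IsGenerated (α := α) (β := β) (k := 0)) := by
        rw [show (1 : ℝ) = numOf fun _ : Fin 0 → (α → ZMod 2) × (β → ZMod 2) => True by
          rw [numOf_true]; simp]
        refine numOf_mono fun H _ => ⟨linearIndependent_empty_type, ?_, fun i => i.elim0⟩
        have hone : LinearIndependent (ZMod 2) fun _ : Fin 1 => fun _ : β => (1 : ZMod 2) :=
          linearIndependent_unique_iff.2 fun h =>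
            one_ne_zero (α := ZMod 2) (congrFun h hβ.some)
        convert hone using 1
        ext i
        rw [Fin.fin_one_eq_zero i]
        rfl
      refine le_trans ?_ this
      have h1 : (0 : ℝ) ≤ 4 * 2 ^ 0 / 2 ^ Fintype.card β := by positivity
      have h2 : (0 : ℝ) ≤ 2 ^ 0 / 2 ^ Fintype.card α := by positivity
      simp only [isotropicModel, Finset.range_zero, Finset.prod_empty]
      linarith
    · refine le_trans ?_ (numOf_nonneg _)
      rw [not_nonempty_iff] at hβ
      have h2 : (0 : ℝ) ≤ 2 ^ 0 / 2 ^ Fintype.card α := by positivity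
      refine mul_nonpos_of_nonneg_of_nonpos (isotropicModel_pos _ _ _).le ?_
      rw [Fintype.card_eq_zero (α := β)]
      simp only [pow_zero] at h2 ⊢
      linarith
  | succ m ih =>
    set x : ℝ := 4 * 2 ^ m / 2 ^ Fintype.card β + 2 ^ m / 2 ^ Fintype.card α with hx
    have hx0 : 0 ≤ x := by positivity
    have hx2 : (1 - 4 * 2 ^ (m + 1) / 2 ^ Fintype.card β - 2 ^ (m + 1) / 2 ^ Fintype.card α : ℝ)
        = 1 - 2 * x := by rw [hx, pow_succ]; ring
    have hx1 : (1 - 4 * 2 ^ m / 2 ^ Fintype.card β - 2 ^ m / 2 ^ Fintype.card α : ℝ)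
        = 1 - x := by rw [hx]; ring
    have hs := mul_le_numOf_isGenerated_succ (α := α) (β := β) m
    rw [hx1] at ih hs
    rw [hx2]
    -- For `x ≥ 1` the lower bound is negative.
    rcases lt_or_ge x 1 with h1 | h1
    · refine le_trans ?_ hs
      refine le_trans ?_ (mul_le_mul_of_nonneg_right ih
        (mul_nonneg (by positivity) (by linarith)))
      rw [isotropicModel_succ]
      have hp : 0 ≤ isotropicModel 1 (Fintype.card α + Fintype.card β) m *
          (2 ^ (Fintype.card α + Fintype.card β) / 2 ^ (1 + m)) :=
        mul_nonneg (isotropicModel_pos _ _ _).le (by positivity)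
      nlinarith [mul_nonneg hp (mul_nonneg hx0 hx0)]
    · refine le_trans ?_ (numOf_nonneg _)
      exact mul_nonpos_of_nonneg_of_nonpos (isotropicModel_pos _ _ _).le (by linarith)

end Halves

/-! ### The output distribution of the row-by-row construction -/

section Construction

variable {h : ℕ}

theorem mem_nextRows {k : ℕ} (L : Fin (k + 1) → Bits h) (R : Fin k → Bits h) (v : Bits h) :
    v ∈ nextRows L R ↔
      IsNext (fun j => L (Fin.last k) ⬝ᵥ L j.castSucc) (L (Fin.last k) ⬝ᵥ L (Fin.last k)) R v := by
  simp [nextRows, IsNext]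

theorem card_nextRows {k : ℕ} (L : Fin (k + 1) → Bits h) {R : Fin k → Bits h}
    (hR : LinearIndependent (ZMod 2) (Fin.cons (fun _ => 1) R : Fin (k + 1) → Bits h)) :
    ((nextRows L R).card : ℝ) = 2 ^ h / 2 ^ (1 + k) := by
  classical
  have := numOf_isNext hR (fun j => L (Fin.last k) ⬝ᵥ L j.castSucc)
    (L (Fin.last k) ⬝ᵥ L (Fin.last k))
  rw [Fintype.card_fin] at this
  rw [← this, numOf]
  congr 2
  ext v
  rw [mem_nextRows]
  simp

open Classical in
/-- One step of `buildRight`: the distribution of the first `k + 1` rows of `R` given the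
outcome of the first `k` steps. -/
noncomputable def buildStep {k : ℕ} (L : Fin (k + 1) → Bits h) :
    Option (Fin k → Bits h) → PMF (Option (Fin (k + 1) → Bits h))
  | none => PMF.pure none
  | some R =>
    if hs : (nextRows L R).Nonempty then
      (PMF.uniformOfFinset (nextRows L R) hs).map fun v =>
        if LinearIndependent (ZMod 2)
            (Fin.cons (fun _ => 1) (Fin.snoc R v : Fin (k + 1) → Bits h) :
              Fin (k + 2) → Bits h) then
          some (Fin.snoc R v : Fin (k + 1) → Bits h)
        else none
    else PMF.pure none

theorem buildRight_succ {k : ℕ} (L : Fin (k + 1) → Bits h) :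
    buildRight (k + 1) L = (buildRight k (Fin.init L)).bind (buildStep L) := by
  rw [buildRight]
  congr 1

open Classical in
theorem buildStep_apply {k : ℕ} (L : Fin (k + 1) → Bits h) (o : Option (Fin k → Bits h))
    (R : Fin k → Bits h) (v : Bits h) :
    buildStep L o (some (Fin.snoc R v)) =
      if o = some R ∧ v ∈ nextRows L R ∧ LinearIndependent (ZMod 2)
          (Fin.cons (fun _ => 1) (Fin.snoc R v : Fin (k + 1) → Bits h) : Fin (k + 2) → Bits h)
      then ((nextRows L R).card : ENNReal)⁻¹ else 0 := by
  cases o with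
  | none => simp [buildStep]
  | some R' =>
    rw [buildStep]
    split_ifs with hs hc hc
    · obtain ⟨h1, h2, h3⟩ := hc
      obtain rfl : R' = R := Option.some.inj h1
      rw [PMF.map_apply, tsum_eq_single v]
      · simp [h3, h2]
      · intro v' hv'
        rw [if_neg]
        split_ifs
        · intro h
          exact hv' ((Fin.snoc_inj.1 (Option.some.inj h)).2).symm
        · simp
    · rw [PMF.map_apply, ENNReal.tsum_eq_zero]
      intro v'
      by_cases h2 : LinearIndependent (ZMod 2)
          (Fin.cons (fun _ => 1) (Fin.snoc R' v' : Fin (k + 1) → Bits h) : Fin (k + 2) → Bits h)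
      · rw [if_pos h2]
        split_ifs with h1
        · obtain ⟨rfl, rfl⟩ := Fin.snoc_inj.1 (Option.some.inj h1)
          rw [PMF.uniformOfFinset_apply, if_neg]
          exact fun h4 => hc ⟨rfl, h4, h2⟩
        · rfl
      · rw [if_neg h2, if_neg (by simp)]
    · obtain ⟨h1, h2, -⟩ := hc
      obtain rfl : R' = R := Option.some.inj h1
      exact absurd ⟨v, h2⟩ hs
    · simp

theorem linearIndependent_one_cons_elim0 (hh : h ≠ 0) (R : Fin 0 → Bits h) :
    LinearIndependent (ZMod 2) (Fin.cons (fun _ => 1) R : Fin 1 → Bits h) := by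
  have hone : LinearIndependent (ZMod 2) fun _ : Fin 1 => fun _ : Fin h => (1 : ZMod 2) :=
    linearIndependent_unique_iff.2 fun h0 =>
      one_ne_zero (α := ZMod 2) (congrFun h0 ⟨0, Nat.pos_of_ne_zero hh⟩)
  convert hone using 1
  ext i
  rw [Fin.fin_one_eq_zero i]
  rfl

open Classical in
/-- The construction of the right half is uniform: every admissible right half has the same
probability. -/
theorem toReal_buildRight_some (hh : h ≠ 0) {k : ℕ} (L R : Fin k → Bits h) :
    (buildRight k L (some R)).toReal = if IsRightHalf L R then (isotropicModel 1 h k)⁻¹ else 0 := by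
  induction k with
  | zero =>
    rw [if_pos ⟨linearIndependent_one_cons_elim0 hh R, fun i => i.elim0⟩]
    rw [Subsingleton.elim R Fin.elim0]
    simp [buildRight, isotropicModel]
  | succ k ih =>
    rw [← Fin.snoc_init_self R]
    generalize Fin.init R = R'
    generalize R (Fin.last k) = v
    rw [buildRight_succ, PMF.bind_apply, tsum_eq_single (some R'), ENNReal.toReal_mul, ih,
      buildStep_apply, isRightHalf_snoc, ← mem_nextRows, Fin.cons_snoc_eq_snoc_cons,
      linearIndependent_finSnoc]
    · by_cases h1 : IsRightHalf (Fin.init L) R'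
      · by_cases h2 : v ∈ nextRows L R' ∧ v ∉ Submodule.span (ZMod 2)
          (Set.range (Fin.cons (fun _ => 1) R' : Fin (k + 1) → Bits h))
        · rw [if_pos h1, if_pos ⟨rfl, h2.1, h1.1, h2.2⟩, if_pos ⟨h1, h2⟩, isotropicModel_succ,
            mul_inv, ENNReal.toReal_inv, ENNReal.toReal_natCast, card_nextRows L h1.1]
        · rw [if_neg (c := _ ∧ _ ∧ _ ∧ _) fun h3 => h2 ⟨h3.2.1, h3.2.2.2⟩,
            if_neg (c := _ ∧ _ ∧ _) fun h3 => h2 h3.2]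
          simp
      · rw [if_neg h1, if_neg (c := IsRightHalf _ _ ∧ _) fun h3 => h1 h3.1, zero_mul]
    · intro o ho
      rw [buildStep_apply, if_neg fun h3 => ho h3.1, mul_zero]

/-- Matrices of width `h + h` as families of pairs of rows of width `h`. -/
def joinEquiv (m h : ℕ) :
    (Fin m → Bits h × Bits h) ≃ Matrix (Fin m) (Fin (h + h)) (ZMod 2) where
  toFun H := joinHalves (fun i => (H i).1) fun i => (H i).2
  invFun H := fun i => (fun j => H i (Fin.castAdd h j), fun j => H i (Fin.natAdd h j))
  left_inv H := by
    ext i j <;> simp [joinHalves, -Fin.natAdd_eq_addNat]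
  right_inv H := by
    ext i j
    refine Fin.addCases (fun j => ?_) (fun j => ?_) j <;> simp [joinHalves, -Fin.natAdd_eq_addNat]

theorem joinHalves_inj {m : ℕ} {L R L' R' : Fin m → Bits h} :
    joinHalves L R = joinHalves L' R' ↔ L = L' ∧ R = R' := by
  constructor
  · intro e
    have := (joinEquiv m h).injective (a₁ := fun i => (L i, R i)) (a₂ := fun i => (L' i, R' i)) e
    simp only [funext_iff, Prod.mk.injEq] at this ⊢
    exact ⟨fun i j => (this i).1 j, fun i j => (this i).2 j⟩
  · rintro ⟨rfl, rfl⟩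
    rfl

theorem map_joinHalves_apply {m : ℕ} (p : PMF (Option (Fin m → Bits h)))
    (L R L' : Fin m → Bits h) :
    (p.map (Option.map (joinHalves L'))) (some (joinHalves L R)) =
      if L = L' then p (some R) else 0 := by
  classical
  rw [PMF.map_apply]
  split_ifs with h1
  · subst h1
    rw [tsum_eq_single (some R)]
    · simp
    · intro o ho
      rw [if_neg]
      cases o with
      | none => simp
      | some R' =>
        intro h2
        have h3 := (joinHalves_inj.1 (Option.some.inj h2)).2
        exact ho (by rw [h3])
  · rw [ENNReal.tsum_eq_zero]
    intro o
    rw [if_neg]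
    cases o with
    | none => simp
    | some R' =>
      intro h2
      exact h1 (joinHalves_inj.1 (Option.some.inj h2)).1

open Classical in
/-- The construction is uniform on the matrices it can produce. -/
theorem toReal_construction_some (hh : h ≠ 0) {m : ℕ} (H : Fin m → Bits h × Bits h) :
    (construction m h (some (joinEquiv m h H))).toReal =
      if IsGenerated H then (isotropicModel 1 (h + h) m)⁻¹ else 0 := by
  change (construction m h (some (joinHalves (fun i => (H i).1) fun i => (H i).2))).toReal = _
  rw [construction, PMF.bind_apply, tsum_eq_single (fun i => (H i).1), ENNReal.toReal_mul]
  · by_cases hL : LinearIndependent (ZMod 2) fun i => (H i).1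
    · rw [if_pos hL, map_joinHalves_apply, if_pos rfl, toReal_buildRight_some hh, mul_ite, mul_zero]
      refine if_congr ⟨fun h2 => ⟨hL, h2⟩, fun h2 => h2.2⟩ ?_ rfl
      rw [isotropicModel_add, mul_inv]
      simp
    · rw [if_neg hL, if_neg fun h2 => hL h2.1]
      simp
  · intro L' hL'
    split_ifs
    · rw [map_joinHalves_apply, if_neg (Ne.symm hL'), mul_zero]
    · simp

theorem mem_generated_iff (hh : h ≠ 0) {m : ℕ} (H : Fin m → Bits h × Bits h) :
    joinEquiv m h H ∈ generated m h ↔ IsGenerated H := by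
  classical
  have h1 := toReal_construction_some hh H
  have h2 := isotropicModel_pos 1 (h + h) m
  rw [generated, Set.mem_ofPred_eq]
  constructor
  · intro h3
    by_contra h4
    rw [if_neg h4, ENNReal.toReal_eq_zero_iff] at h1
    exact h1.elim h3 (PMF.apply_ne_top _ _)
  · intro h3 h4
    rw [if_pos h3, h4] at h1
    exact (inv_pos.2 h2).ne h1

theorem ncard_generated (hh : h ≠ 0) (m : ℕ) :
    ((generated m h).ncard : ℝ) = numOf (IsGenerated (α := Fin h) (β := Fin h) (k := m)) := by
  classical
  rw [numOf, Nat.cast_inj, ← Set.ncard_coe_finset]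
  refine (Set.ncard_congr (fun H _ => joinEquiv m h H) (fun H hH => ?_)
    (fun _ _ _ _ e => (joinEquiv m h).injective e) fun H hH => ?_).symm
  · exact (mem_generated_iff hh H).2 (by simpa using hH)
  · obtain ⟨H, rfl⟩ := (joinEquiv m h).surjective H
    exact ⟨H, by simpa using (mem_generated_iff hh H).1 hH, rfl⟩

/-- The probability of halting is the relative defect of the number of generated matrices from the
model count. -/
theorem toReal_construction_none (hh : h ≠ 0) (m : ℕ) :
    (construction m h none).toReal =
      1 - numOf (IsGenerated (α := Fin h) (β := Fin h) (k := m)) / isotropicModel 1 (h + h) m := by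
  classical
  have h1 := (construction m h).tsum_coe
  rw [tsum_fintype, Fintype.sum_option] at h1
  have h2 := congrArg ENNReal.toReal h1
  rw [ENNReal.toReal_add (PMF.apply_ne_top _ _)
    (ENNReal.sum_ne_top.2 fun _ _ => PMF.apply_ne_top _ _),
    ENNReal.toReal_sum fun _ _ => PMF.apply_ne_top _ _, ENNReal.toReal_one,
    ← Equiv.sum_comp (joinEquiv m h)] at h2
  simp only [toReal_construction_some hh] at h2
  rw [numOf_eq_sum, Finset.sum_div]
  have h3 : ∀ H : Fin m → Bits h × Bits h,
      (if IsGenerated H then (isotropicModel 1 (h + h) m)⁻¹ else 0) =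
        (if IsGenerated H then (1 : ℝ) else 0) / isotropicModel 1 (h + h) m := fun H => by
    split_ifs <;> simp
  simp only [h3] at h2
  linarith

theorem isDualContained_iff {m n : ℕ} (H : Matrix (Fin m) (Fin n) (ZMod 2)) :
    IsDualContained H ↔ ∀ i j, H i ⬝ᵥ H j = 0 := by
  rw [IsDualContained, ← Matrix.ext_iff]
  rfl

theorem mem_dualContained {m n : ℕ} (H : Matrix (Fin m) (Fin n) (ZMod 2)) :
    H ∈ dualContained m n ↔ (∀ i j, H i ⬝ᵥ H j = 0) ∧ LinearIndependent (ZMod 2) H := by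
  simp only [dualContained, Finset.mem_filter, isDualContained_iff, Finset.mem_univ, true_and]
  rfl

theorem generated_subset_dualContained (h m : ℕ) :
    generated m h ⊆ (dualContained m (h + h) : Set _) := by
  intro H hH
  obtain ⟨H, rfl⟩ := (joinEquiv m h).surjective H
  rw [Finset.mem_coe, mem_dualContained]
  rcases Nat.eq_zero_or_pos m with rfl | hm
  · exact ⟨fun i => i.elim0, linearIndependent_empty_type⟩
  have hh : h ≠ 0 := by
    rintro rfl
    apply hH
    rw [construction, PMF.bind_apply, ENNReal.tsum_eq_zero]
    intro L
    have : ¬ LinearIndependent (ZMod 2) L := fun hL =>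
      hL.ne_zero ⟨0, hm⟩ (Subsingleton.elim _ _)
    rw [if_neg this]
    simp
  have h1 := (mem_generated_iff hh H).1 hH
  constructor
  · intro i j
    rw [← h1.2.2 i j]
    simp [joinEquiv, joinHalves, dotProduct, Fin.sum_univ_add, -Fin.natAdd_eq_addNat]
  · have h2 : LinearIndependent (ZMod 2) (LinearMap.funLeft (ZMod 2) (ZMod 2) (Fin.castAdd h) ∘
        (joinEquiv m h H)) := by
      convert h1.1 using 1
      ext i j
      exact Fin.append_left _ _ _
    exact h2.of_comp _

end Construction

/-! ### Counting dual-contained matrices -/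

section Dual

variable {m n : ℕ}

theorem frac_eq_numOf {X : Type*} [Fintype X] (s : Finset X) (P : X → Prop) :
    frac s P = numOf (fun x => x ∈ s ∧ P x) / s.card := by
  classical
  rw [frac, numOf]
  congr 2
  congr 1
  ext x
  simp

theorem card_eq_numOf {X : Type*} [Fintype X] (s : Finset X) :
    (s.card : ℝ) = numOf (fun x => x ∈ s) := by
  classical
  rw [numOf, Nat.cast_inj]
  exact congrArg Finset.card (Finset.ext fun x => by simp)

theorem isotropicTo_one_iff (H : Fin m → Bits n) :
    IsotropicTo (fun _ : Fin 1 => fun _ => 1) H ↔ ∀ i j, H i ⬝ᵥ H j = 0 := by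
  refine ⟨fun h => h.1, fun h => ⟨h, fun _ i => ?_⟩⟩
  rw [← dotProduct_self_eq]
  exact h i i

theorem card_dualContained_eq (m n : ℕ) :
    ((dualContained m n).card : ℝ) = numOf fun H : Fin m → Bits n =>
      IsotropicTo (fun _ : Fin 1 => fun _ => 1) H ∧ LinearIndependent (ZMod 2) H := by
  rw [card_eq_numOf]
  exact numOf_congr fun H =>
    (mem_dualContained H).trans (and_congr_left' (isotropicTo_one_iff H).symm)

theorem linearIndependent_one (hn : 0 < n) :
    LinearIndependent (ZMod 2) (fun _ : Fin 1 => fun _ : Fin n => (1 : ZMod 2)) :=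
  linearIndependent_unique_iff.2 fun h => one_ne_zero (α := ZMod 2) (congrFun h ⟨0, hn⟩)

theorem abs_card_dualContained_sub_le (hn : 0 < n) (m : ℕ) :
    |((dualContained m n).card : ℝ) / isotropicModel 1 n m - 1|
      ≤ 16 * (m + 1) * (4 ^ m / 2 ^ n) := by
  rw [card_dualContained_eq]
  exact abs_numOf_isotropic_sub_le one_le_two ⟨0, rfl⟩ (linearIndependent_one hn) m

/-- Below half the length, transverse families can always be extended. -/
theorem dualContained_nonempty (h : 2 * m < n ∨ m = 0) : (dualContained m n).Nonempty := by
  rcases Nat.eq_zero_or_pos m with rfl | hm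
  · exact ⟨0, (mem_dualContained _).2 ⟨fun i => i.elim0, linearIndependent_empty_type⟩⟩
  have h2 : 2 * m < n := by omega
  have hW : ∃ l : Fin 1, (fun _ : Fin 1 => fun _ : Fin n => (1 : ZMod 2)) l = fun _ => 1 :=
    ⟨0, rfl⟩
  have key : ∀ k, 2 * k < n → 0 < numOf (IsTransverse (n := n)
      (fun _ : Fin 1 => fun _ => 1) (k := k)) := by
    intro k
    induction k with
    | zero =>
      intro hn
      refine numOf_pos ⟨0, ⟨fun i => i.elim0, fun _ i => i.elim0⟩, ?_⟩
      rw [Fin.append_right_nil _ _ rfl]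
      exact linearIndependent_one hn
    | succ k ih =>
      intro hk
      refine lt_of_lt_of_le ?_ (mul_le_numOf_isTransverse_succ hW k)
      refine mul_pos (ih (by omega)) (sub_pos.2 ?_)
      rw [lt_div_iff₀ (by positivity), ← pow_add]
      exact pow_lt_pow_right₀ one_lt_two (by omega)
  obtain ⟨H, hH⟩ := exists_of_numOf_pos (key m h2)
  refine ⟨H, (mem_dualContained _).2 ⟨hH.1.1, ?_⟩⟩
  have := hH.2.comp (Fin.natAdd 1) (Fin.natAdd_injective m 1)
  convert this using 1
  ext i
  simp

theorem mulVec_eq_zero_iff (H : Matrix (Fin m) (Fin n) (ZMod 2)) (u : Bits n) :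
    H *ᵥ u = 0 ↔ ∀ i, u ⬝ᵥ H i = 0 := by
  rw [funext_iff]
  refine forall_congr' fun i => ?_
  rw [dotProduct_comm]
  rfl

/-- A vector other than `0` and the all-ones vector is annihilated by about one dual-contained
matrix in `2 ^ m`. -/
theorem abs_numOf_mulVec_sub_le {u : Bits n} (h0 : u ≠ 0) (h1 : u ≠ fun _ => 1) (m : ℕ) :
    |2 ^ m * numOf (fun H => H ∈ dualContained m n ∧ H *ᵥ u = 0) / isotropicModel 1 n m - 1|
      ≤ 16 * (m + 1) * (4 ^ m / 2 ^ n) := by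
  have hi : LinearIndependent (ZMod 2) (![fun _ => 1, u] : Fin 2 → Bits n) := by
    rw [LinearIndependent.pair_iff]
    intro s t hst
    have h2 : ∀ a : ZMod 2, a = 0 ∨ a = 1 := by decide
    rcases h2 s with rfl | rfl <;> rcases h2 t with rfl | rfl
    · exact ⟨rfl, rfl⟩
    · exact absurd (by simpa using hst) h0
    · exfalso
      apply h0
      funext i
      have := congrFun hst i
      simp at this
    · exfalso
      apply h1
      funext i
      have h3 := congrFun hst i
      simp only [one_smul, Pi.add_apply, Pi.zero_apply, CharTwo.add_eq_zero] at h3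
      exact h3.symm
  have h2 := abs_numOf_isotropic_sub_le le_rfl ⟨0, rfl⟩ hi m
  have hM : isotropicModel 1 n m = 2 ^ m * isotropicModel 2 n m := by
    clear h2
    induction m with
    | zero => simp [isotropicModel]
    | succ m ih =>
      rw [isotropicModel_succ, isotropicModel_succ, ih, pow_add, pow_add, pow_succ]
      field_simp
      ring
  rw [hM, mul_div_mul_left _ _ (by positivity)]
  convert h2 using 4
  refine numOf_congr fun H => ?_
  rw [mem_dualContained, mulVec_eq_zero_iff]
  constructor
  · rintro ⟨⟨h3, h4⟩, h5⟩
    exact ⟨⟨h3, Fin.forall_fin_two.2 ⟨((isotropicTo_one_iff H).2 h3).2 0, h5⟩⟩, h4⟩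
  · rintro ⟨⟨h3, h5⟩, h6⟩
    exact ⟨⟨h3, h6⟩, (Fin.forall_fin_two.1 h5).2⟩

end Dual

/-! ### The law of a set of columns -/

section Columns

variable {m n : ℕ}

/-- Restriction of a matrix to the columns `S`. -/
def restrictCols (S : Finset (Fin n)) (H : Matrix (Fin m) (Fin n) (ZMod 2)) :
    Matrix (Fin m) S (ZMod 2) :=
  H.submatrix id fun j : S => (j : Fin n)

theorem frac_restrictCols (S : Finset (Fin n)) (A : Matrix (Fin m) S (ZMod 2)) :
    frac (dualContained m n) (fun H => H.submatrix id (fun j : S => (j : Fin n)) = A) =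
      numOf (fun H => restrictCols S H = A ∧ H ∈ dualContained m n) / (dualContained m n).card := by
  rw [frac_eq_numOf]
  congr 1
  exact numOf_congr fun H => and_comm

theorem card_matrix (m : ℕ) (S : Finset (Fin n)) :
    (Fintype.card (Matrix (Fin m) S (ZMod 2)) : ℝ) = 2 ^ (m * S.card) := by
  rw [← Fintype.card_congr (Matrix.of (m := Fin m) (n := S) (α := ZMod 2))]
  simp only [Fintype.card_fun, Fintype.card_fin, Fintype.card_coe, ZMod.card]
  push_cast
  rw [← pow_mul, mul_comm S.card]

/-- Forgetting columns does not increase the distance from the uniform law. -/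
theorem columnsTV_mono {S T : Finset (Fin n)} (hST : S ⊆ T) :
    columnsTV m n S ≤ columnsTV m n T := by
  classical
  let f : Matrix (Fin m) T (ZMod 2) →+ Matrix (Fin m) S (ZMod 2) :=
    { toFun := fun A => A.submatrix id fun j : S => ⟨j, hST j.2⟩
      map_zero' := rfl
      map_add' := fun _ _ => rfl }
  have hf : Function.Surjective f := fun A => by
    refine ⟨fun i j => if hj : (j : Fin n) ∈ S then A i ⟨j, hj⟩ else 0, ?_⟩
    ext i j
    exact dif_pos j.2
  have hu : ∀ A, ∑ B, (if f B = A then (1 : ℝ) / 2 ^ (m * T.card) else 0)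
      = 1 / 2 ^ (m * S.card) := fun A => by
    have h := numOf_fiber f hf A
    rw [numOf_eq_sum] at h
    have h1 : ∀ B, (if f B = A then (1 : ℝ) / 2 ^ (m * T.card) else 0)
        = (if f B = A then 1 else 0) * (1 / 2 ^ (m * T.card)) := fun B => by
      split_ifs <;> simp
    simp only [h1]
    rw [← Finset.sum_mul, h]
    rw [card_matrix, card_matrix]
    field_simp
  have hp : ∀ A, numOf (fun H => restrictCols S H = A ∧ H ∈ dualContained m n) =
      ∑ B, if f B = A then
        numOf (fun H => restrictCols T H = B ∧ H ∈ dualContained m n) else 0 := by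
    intro A
    rw [numOf_eq_sum_fiber (restrictCols T)]
    refine Finset.sum_congr rfl fun B _ => ?_
    have hr : ∀ H : Matrix (Fin m) (Fin n) (ZMod 2),
        f (restrictCols T H) = restrictCols S H := fun H => rfl
    split_ifs with h
    · refine numOf_congr fun H => ⟨fun h1 => ⟨h1.1, h1.2.2⟩, fun h1 => ⟨h1.1, ?_, h1.2⟩⟩
      rw [← hr, h1.1, h]
    · refine le_antisymm (le_of_not_gt fun h1 => ?_) (numOf_nonneg _)
      obtain ⟨H, h2, h3, -⟩ := exists_of_numOf_pos h1
      exact h (by rw [← h2, hr, h3])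
  rw [columnsTV, columnsTV]
  refine mul_le_mul_of_nonneg_left ?_ (by norm_num)
  simp only [frac_restrictCols]
  have h1 : ∀ A, |numOf (fun H => restrictCols S H = A ∧ H ∈ dualContained m n)
      / (dualContained m n).card - 1 / 2 ^ (m * S.card)| ≤
      ∑ B, if f B = A then |numOf (fun H => restrictCols T H = B ∧ H ∈ dualContained m n)
      / (dualContained m n).card - 1 / 2 ^ (m * T.card)| else 0 := fun A => by
    rw [hp, ← hu A, Finset.sum_div, ← Finset.sum_sub_distrib]
    refine (Finset.abs_sum_le_sum_abs _ _).trans (Finset.sum_le_sum fun B _ => ?_)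
    split_ifs <;> simp
  refine (Finset.sum_le_sum fun A _ => h1 A).trans_eq ?_
  rw [Finset.sum_comm]
  exact Finset.sum_congr rfl fun B _ => by simp

/-- Splitting the columns into `S` and its complement. -/
def splitCols (m : ℕ) (S : Finset (Fin n)) :
    (Fin m → Bits n) ≃ (Fin m → (S → ZMod 2) × ({j // j ∉ S} → ZMod 2)) :=
  Equiv.arrowCongr (Equiv.refl _) (Equiv.piEquivPiSubtypeProd (· ∈ S) fun _ => ZMod 2)

theorem mem_dualContained_of_isGenerated {S : Finset (Fin n)} {H : Fin m → Bits n}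
    (hH : IsGenerated (splitCols m S H)) : Matrix.of H ∈ dualContained m n := by
  rw [mem_dualContained]
  constructor
  · intro i j
    rw [← hH.2.2 i j]
    refine (Fintype.sum_subtype_add_sum_subtype (· ∈ S) fun k => H i k * H j k).symm.trans
      (congrArg₂ (· + ·) ?_ ?_) <;> exact Finset.sum_congr (by ext; simp) fun _ _ => rfl
  · have h2 : LinearIndependent (ZMod 2)
        (LinearMap.funLeft (ZMod 2) (ZMod 2) (fun j : S => (j : Fin n)) ∘ H) := hH.1
    exact h2.of_comp _

/-- Each value of the columns `S` is taken by at most as many producible matrices as in the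
model. -/
theorem numOf_isGenerated_restrict_le (S : Finset (Fin n)) (A : Matrix (Fin m) S (ZMod 2)) :
    numOf (fun H => restrictCols S H = A ∧ IsGenerated (splitCols m S H)) ≤
      isotropicModel 1 (n - S.card) m := by
  classical
  have h := numOf_equiv ((splitCols m S).trans (Equiv.arrowProdEquivProdArrow (Fin m)
    (fun _ => S → ZMod 2) (fun _ => {j // j ∉ S} → ZMod 2)))
    (fun x => x.1 = A ∧ IsRightHalf x.1 x.2)
  refine (numOf_mono fun H hH => ?_).trans (h.trans_le ((numOf_prod_le (Q := fun L => L = A)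
    (fun _ _ h => h.1) fun L _ => (numOf_mono fun R h => h.2).trans
      (numOf_isRightHalf_le L)).trans_eq ?_))
  · exact ⟨hH.1, hH.2.2⟩
  · refine (congrArg₂ (· * ·) (numOf_eq_one A) rfl).trans ?_
    simp [Fintype.card_subtype_compl]

/-- Let `a A` be the number of dual-contained and `b A` that of producible matrices whose
columns `S` are `A`, and `K` the model value of both. Then `b A ≤ a A` and `b A ≤ K`, so that the sums
over `A` of the distances are differences of total counts. -/
theorem columnsTV_le (S : Finset (Fin n)) {d e : ℝ}
    (hd : |((dualContained m n).card : ℝ) / isotropicModel 1 n m - 1| ≤ d)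
    (hD : (dualContained m n).Nonempty)
    (he : 1 - e ≤ numOf (fun H => IsGenerated (splitCols m S H)) / isotropicModel 1 n m) :
    columnsTV m n S ≤ d + e := by
  classical
  set K := isotropicModel 1 (n - S.card) m with hK
  set M := isotropicModel 1 n m with hM
  have hK0 : 0 < K := isotropicModel_pos _ _ _
  have hM0 : 0 < M := isotropicModel_pos _ _ _
  have hMK : M = 2 ^ (m * S.card) * K := by
    have hle : S.card ≤ n := by simpa using S.card_le_univ
    rw [hM, hK, mul_comm m, pow_mul, ← isotropicModel_add, Nat.add_sub_cancel' hle]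
  set D : ℝ := ((dualContained m n).card : ℝ)
  have hD0 : 0 < D := Nat.cast_pos.2 (Finset.card_pos.2 hD)
  let a : Matrix (Fin m) S (ZMod 2) → ℝ := fun A =>
    numOf (fun H => restrictCols S H = A ∧ H ∈ dualContained m n)
  let b : Matrix (Fin m) S (ZMod 2) → ℝ := fun A =>
    numOf (fun H => restrictCols S H = A ∧ IsGenerated (splitCols m S H))
  have ha : ∑ A, a A = D := by
    rw [show D = _ from card_eq_numOf _, numOf_eq_sum_fiber (restrictCols S)]
  have hb : ∑ A, b A = numOf fun H => IsGenerated (splitCols m S H) :=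
    (numOf_eq_sum_fiber (restrictCols S) _).symm.trans
      (numOf_equiv Matrix.of fun H => IsGenerated (splitCols m S H)).symm
  have hba : ∀ A, b A ≤ a A := fun A => numOf_mono fun H hH =>
    ⟨hH.1, mem_dualContained_of_isGenerated hH.2⟩
  have hbK : ∀ A, b A ≤ K := fun A => numOf_isGenerated_restrict_le S A
  have hcard : (Fintype.card (Matrix (Fin m) S (ZMod 2)) : ℝ) * K = M := by
    rw [hMK, card_matrix]
  have hterm : ∀ A, |a A / D - 1 / 2 ^ (m * S.card)| ≤
      a A / D * |D / M - 1| + (a A - b A) / M + (K - b A) / M := fun A => by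
    have e1 : (1 : ℝ) / 2 ^ (m * S.card) = K / M := by rw [hMK]; field_simp
    have e2 : a A / D - K / M = -(a A / D * (D / M - 1)) + (a A - b A) / M - (K - b A) / M := by
      field_simp
      ring
    rw [e1, e2]
    refine (abs_sub _ _).trans (add_le_add ((abs_add_le _ _).trans (add_le_add ?_ ?_)) ?_)
    · rw [abs_neg, abs_mul, abs_of_nonneg (div_nonneg (numOf_nonneg _) hD0.le)]
    · rw [abs_of_nonneg (div_nonneg (sub_nonneg.2 (hba A)) hM0.le)]
    · rw [abs_of_nonneg (div_nonneg (sub_nonneg.2 (hbK A)) hM0.le)]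
  rw [columnsTV]
  simp only [frac_restrictCols]
  change 1 / 2 * ∑ A, |a A / D - 1 / 2 ^ (m * S.card)| ≤ d + e
  have hsum := Finset.sum_le_sum fun A (_ : A ∈ Finset.univ) => hterm A
  rw [Finset.sum_add_distrib, Finset.sum_add_distrib, ← Finset.sum_mul, ← Finset.sum_div,
    ← Finset.sum_div, ← Finset.sum_div, Finset.sum_sub_distrib, Finset.sum_sub_distrib, ha, hb,
    Finset.sum_const, Finset.card_univ, nsmul_eq_mul, hcard, div_self hD0.ne', one_mul, sub_div,
    sub_div, div_self hM0.ne'] at hsum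
  have h1 := (abs_le.1 hd).2
  linarith

end Columns

/-! ### Asymptotics below half the length -/

section Asymptotics

theorem two_pow_div_le {m s : ℕ} {x : ℝ} (h : (m : ℝ) ≤ s - x) :
    (2 : ℝ) ^ m / 2 ^ s ≤ (2 : ℝ) ^ (-x) := by
  rw [← Real.rpow_natCast, ← Real.rpow_natCast, ← Real.rpow_sub two_pos]
  exact Real.rpow_le_rpow_of_exponent_le one_le_two (by linarith)

theorem four_pow_div_le {m n : ℕ} {ε : ℝ} (hε : 0 < ε) (h : (m : ℝ) ≤ (n : ℝ) / 2 - n * ε) :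
    (4 : ℝ) ^ m / 2 ^ n ≤ (2 : ℝ) ^ (-(n * ε)) := by
  have h0 : 0 ≤ n * ε := by positivity
  rw [show (4 : ℝ) = 2 ^ 2 by norm_num, ← pow_mul]
  refine two_pow_div_le ?_
  push_cast
  linarith

theorem two_pow_div_half_le {m n s : ℕ} {ε : ℝ} (hs : n ≤ 2 * s + 1)
    (h : (m : ℝ) ≤ (n : ℝ) / 2 - n * ε) :
    (2 : ℝ) ^ m / 2 ^ s ≤ 2 * (2 : ℝ) ^ (-(n * ε)) := by
  have hs' : (n : ℝ) ≤ 2 * s + 1 := by exact_mod_cast hs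
  refine (two_pow_div_le (x := n * ε - 1) (by linarith)).trans_eq ?_
  rw [show -((n : ℝ) * ε - 1) = 1 + -(n * ε) by ring, Real.rpow_add two_pos, Real.rpow_one]

/-- A common error term for all counts with at most `n / 2 - n ε` rows. -/
noncomputable def errorTerm (ε : ℝ) (n : ℕ) : ℝ := 16 * (n + 1) * (2 : ℝ) ^ (-(n * ε))

theorem tendsto_mul_rpow_neg {c : ℝ} (hc : 0 < c) :
    Tendsto (fun n : ℕ => ((n : ℝ) + 1) * (2 : ℝ) ^ (-(n * c))) atTop (𝓝 0) := by
  have h1 : (2 : ℝ) ^ (-c) < 1 := Real.rpow_lt_one_of_one_lt_of_neg one_lt_two (by linarith)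
  have h0 : (0 : ℝ) ≤ (2 : ℝ) ^ (-c) := by positivity
  have h2 := (tendsto_self_mul_const_pow_of_lt_one h0 h1).add
    (tendsto_pow_atTop_nhds_zero_of_lt_one h0 h1)
  rw [add_zero] at h2
  refine h2.congr fun n => ?_
  rw [← Real.rpow_natCast, ← Real.rpow_mul zero_le_two, show -c * (n : ℝ) = -(n * c) by ring]
  ring

theorem tendsto_errorTerm {ε : ℝ} (hε : 0 < ε) : Tendsto (errorTerm ε) atTop (𝓝 0) := by
  have h := (tendsto_mul_rpow_neg hε).const_mul 16
  rw [mul_zero] at h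
  exact h.congr fun n => by rw [errorTerm]; ring

theorem abs_div_sub_one_le {a d x : ℝ} (hx : x ≤ 1 / 2) (ha : |a - 1| ≤ x) (hd : |d - 1| ≤ x) :
    |a / d - 1| ≤ 4 * x := by
  rw [abs_le] at ha hd
  have hd0 : 1 / 2 ≤ d := by linarith
  rw [div_sub_one (by linarith), abs_div, abs_of_pos (show 0 < d by linarith),
    div_le_iff₀ (by linarith), abs_le]
  constructor <;> nlinarith

variable {m n : ℕ} {ε : ℝ}

theorem error_le_errorTerm (hε : 0 < ε) (h : (m : ℝ) ≤ (n : ℝ) / 2 - n * ε) :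
    16 * ((m : ℝ) + 1) * (4 ^ m / 2 ^ n) ≤ errorTerm ε n := by
  have h0 : 0 ≤ (n : ℝ) := Nat.cast_nonneg n
  have h1 : 0 ≤ n * ε := by positivity
  rw [errorTerm]
  exact mul_le_mul (by linarith) (four_pow_div_le hε h) (by positivity) (by positivity)

theorem abs_card_dualContained_sub_le_errorTerm (hε : 0 < ε) (hn : 0 < n)
    (h : (m : ℝ) ≤ (n : ℝ) / 2 - n * ε) :
    |((dualContained m n).card : ℝ) / isotropicModel 1 n m - 1| ≤ errorTerm ε n :=
  (abs_card_dualContained_sub_le hn m).trans (error_le_errorTerm hε h)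

theorem dualContained_nonempty_of_le (hε : 0 < ε) (h : (m : ℝ) ≤ (n : ℝ) / 2 - n * ε) :
    (dualContained m n).Nonempty := by
  refine dualContained_nonempty ?_
  rcases Nat.eq_zero_or_pos n with rfl | hn
  · right
    have : (m : ℝ) ≤ 0 := by simpa using h
    exact_mod_cast le_antisymm this (Nat.cast_nonneg m)
  · left
    have h1 : 0 < (n : ℝ) * ε := mul_pos (Nat.cast_pos.2 hn) hε
    have h2 : (2 * m : ℝ) < n := by linarith
    exact_mod_cast h2

theorem two_pow_mul_frac_eq (m n : ℕ) (u : Bits n) :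
    2 ^ m * frac (dualContained m n) (fun H => H *ᵥ u = 0) =
      (2 ^ m * numOf (fun H => H ∈ dualContained m n ∧ H *ᵥ u = 0) / isotropicModel 1 n m) /
        ((dualContained m n).card / isotropicModel 1 n m) := by
  rw [frac_eq_numOf, div_div_div_cancel_right₀ (isotropicModel_pos 1 n m).ne', mul_div_assoc]

theorem abs_two_pow_mul_frac_sub_le (hε : 0 < ε) (hn : 0 < n) (h : (m : ℝ) ≤ (n : ℝ) / 2 - n * ε)
    (he : errorTerm ε n ≤ 1 / 2) {u : Bits n} (h0 : u ≠ 0) (hu : 2 * hammingNorm u < n) :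
    |2 ^ m * frac (dualContained m n) (fun H => H *ᵥ u = 0) - 1| ≤ 4 * errorTerm ε n := by
  have h1 : u ≠ fun _ => 1 := by
    rintro rfl
    have : hammingNorm (fun _ : Fin n => (1 : ZMod 2)) = n := by simp [hammingNorm]
    omega
  rw [two_pow_mul_frac_eq]
  exact abs_div_sub_one_le he ((abs_numOf_mulVec_sub_le h0 h1 m).trans (error_le_errorTerm hε h))
    (abs_card_dualContained_sub_le_errorTerm hε hn h)

theorem columnsTV_le_errorTerm (hε : 0 < ε) (hn : 0 < n) (h : (m : ℝ) ≤ (n : ℝ) / 2 - n * ε)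
    {S : Finset (Fin n)} (hS : 2 * S.card ≤ n) : columnsTV m n S ≤ 2 * errorTerm ε n := by
  -- Enlarge `S` to half of the columns, so that the left block can have independent rows.
  obtain ⟨T, hST, hT⟩ := Finset.exists_superset_card_eq (s := S) (n := n / 2) (by omega)
    (by rw [Fintype.card_fin]; omega)
  refine (columnsTV_mono hST).trans ?_
  rw [two_mul]
  refine columnsTV_le T (abs_card_dualContained_sub_le_errorTerm hε hn h)
    (dualContained_nonempty_of_le hε h) ?_
  have h1 := le_numOf_isGenerated (α := T) (β := {j // j ∉ T}) m
  have hc : Fintype.card {j // j ∉ T} = n - n / 2 := by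
    rw [Fintype.card_subtype_compl]
    simp [hT]
  rw [← numOf_equiv (splitCols m T), hc, Fintype.card_coe, hT, Nat.add_sub_cancel' (by omega)] at h1
  rw [le_div_iff₀ (isotropicModel_pos _ _ _), mul_comm]
  refine le_trans (mul_le_mul_of_nonneg_left ?_ (isotropicModel_pos _ _ _).le) h1
  have h2 := two_pow_div_half_le (s := n / 2) (by omega) h
  have h3 := two_pow_div_half_le (s := n - n / 2) (by omega) h
  have hr : (0 : ℝ) ≤ (2 : ℝ) ^ (-(n * ε)) := by positivity
  have h4 : 10 * (2 : ℝ) ^ (-(n * ε)) ≤ errorTerm ε n := by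
    rw [errorTerm]
    have : (0 : ℝ) ≤ n := Nat.cast_nonneg n
    nlinarith [mul_nonneg this hr]
  rw [mul_div_assoc]
  linarith

theorem toReal_construction_none_le {h m : ℕ}
    (hm : (m : ℝ) ≤ ((h + h : ℕ) : ℝ) / 2 - ((h + h : ℕ) : ℝ) * ε) :
    (construction m h none).toReal ≤ 5 * (2 : ℝ) ^ (-(((h + h : ℕ) : ℝ) * ε)) := by
  rcases eq_or_ne h 0 with rfl | hh
  · have h1 : (construction m 0 none).toReal ≤ 1 :=
      ENNReal.toReal_le_of_le_ofReal zero_le_one (by simpa using PMF.coe_le_one _ _)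
    refine h1.trans ?_
    norm_num
  · rw [toReal_construction_none hh]
    have h1 := le_numOf_isGenerated (α := Fin h) (β := Fin h) m
    rw [Fintype.card_fin, mul_comm, ← le_div_iff₀ (isotropicModel_pos _ _ _)] at h1
    have h2 : (2 : ℝ) ^ m / 2 ^ h ≤ (2 : ℝ) ^ (-(((h + h : ℕ) : ℝ) * ε)) := by
      refine two_pow_div_le ?_
      push_cast at hm ⊢
      linarith
    rw [mul_div_assoc] at h1
    linarith

theorem abs_ncard_generated_sub_le {h m : ℕ} (hh : h ≠ 0)
    (hm : (m : ℝ) ≤ ((h + h : ℕ) : ℝ) / 2 - ((h + h : ℕ) : ℝ) * ε) :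
    |((generated m h).ncard : ℝ) / isotropicModel 1 (h + h) m - 1| ≤ errorTerm ε (h + h) := by
  have h1 := toReal_construction_none_le hm
  have h0 : 0 ≤ (construction m h none).toReal := ENNReal.toReal_nonneg
  rw [toReal_construction_none hh] at h0 h1
  rw [ncard_generated hh]
  have hr : (0 : ℝ) ≤ (2 : ℝ) ^ (-(((h + h : ℕ) : ℝ) * ε)) := by positivity
  have h4 : 5 * (2 : ℝ) ^ (-(((h + h : ℕ) : ℝ) * ε)) ≤ errorTerm ε (h + h) := by
    rw [errorTerm]
    have : (0 : ℝ) ≤ ((h + h : ℕ) : ℝ) := Nat.cast_nonneg _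
    nlinarith [mul_nonneg this hr]
  rw [abs_le]
  constructor <;> linarith

theorem eventually_generated (hε : 0 < ε) {δ : ℝ} (hδ : 0 < δ) : ∀ᶠ h : ℕ in atTop, ∀ m : ℕ,
    (m : ℝ) ≤ ((h + h : ℕ) : ℝ) / 2 - ((h + h : ℕ) : ℝ) * ε →
      |((generated m h).ncard : ℝ) / countModel m (h + h) - 1| ≤ δ ∧
      |((generated m h).ncard : ℝ) / ((dualContained m (h + h)).card : ℝ) - 1| ≤ δ := by
  have ht : Tendsto (fun h : ℕ => errorTerm ε (h + h)) atTop (𝓝 0) :=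
    (tendsto_errorTerm hε).comp (tendsto_atTop_mono (fun h => Nat.le_add_left h h) tendsto_id)
  filter_upwards [ht.eventually_le_const (show (0 : ℝ) < min (1 / 2) (δ / 4) by positivity),
    eventually_gt_atTop 0] with h he hh m hm
  rw [le_min_iff] at he
  have h1 := abs_ncard_generated_sub_le hh.ne' hm
  rw [countModel_eq]
  refine ⟨by linarith [he.2], ?_⟩
  rw [← div_div_div_cancel_right₀ (isotropicModel_pos 1 (h + h) m).ne']
  exact (abs_div_sub_one_le he.1 h1 (abs_card_dualContained_sub_le_errorTerm hε
    (by omega) hm)).trans (by linarith [he.2])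

theorem eventually_dualContained (hε : 0 < ε) {δ : ℝ} (hδ : 0 < δ) : ∀ᶠ n : ℕ in atTop, ∀ m : ℕ,
    (m : ℝ) ≤ (n : ℝ) / 2 - n * ε →
      |((dualContained m n).card : ℝ) / countModel m n - 1| ≤ δ ∧
      (∀ S : Finset (Fin n), 2 * S.card ≤ n → columnsTV m n S ≤ δ) ∧
      (∀ x y : Bits n, x ≠ y → 2 * hammingNorm (x + y) < n →
        |2 ^ m * frac (dualContained m n) (fun H => H *ᵥ (x + y) = 0) - 1| ≤ δ) := by
  filter_upwards [(tendsto_errorTerm hε).eventually_le_const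
    (show (0 : ℝ) < min (1 / 2) (δ / 4) by positivity), eventually_gt_atTop 0] with n he hn m hm
  rw [le_min_iff] at he
  refine ⟨?_, fun S hS => ?_, fun x y hxy hu => ?_⟩
  · rw [countModel_eq]
    exact (abs_card_dualContained_sub_le_errorTerm hε hn hm).trans (by linarith [he.2])
  · exact (columnsTV_le_errorTerm hε hn hm hS).trans (by linarith [he.2])
  · refine (abs_two_pow_mul_frac_sub_le hε hn hm he.1 (fun h => hxy ?_) hu).trans
      (by linarith [he.2])
    funext i
    exact CharTwo.add_eq_zero.1 (congrFun h i)

end Asymptotics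

/-! ### CSS codes -/

section CSS

variable {m n : ℕ}

theorem bitSign_add (s t : ZMod 2) : bitSign (s + t) = bitSign s * bitSign t := by
  revert s t
  simp only [bitSign, ← pow_add]
  intro s t
  rw [neg_one_pow_eq_pow_mod_two, neg_one_pow_eq_pow_mod_two (s.val + t.val)]
  congr 1
  revert s t
  decide

theorem bitSign_mul_self (s : ZMod 2) : bitSign s * bitSign s = 1 := by
  rw [← bitSign_add, CharTwo.add_self_eq_zero]
  simp [bitSign]

theorem bitSign_eq_one_iff (s : ZMod 2) : bitSign s = 1 ↔ s = 0 := by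
  have h : ∀ a : ZMod 2, a = 0 ∨ a = 1 := by decide
  rcases h s with rfl | rfl
  · simp [bitSign]
  · simp only [bitSign, one_ne_zero, iff_false]
    norm_num [ZMod.val_one]

theorem norm_bitSign (s : ZMod 2) : ‖bitSign s‖ = 1 := by
  simp [bitSign]

theorem bits_add_add_cancel (v a : Bits n) : v + a + a = v := by
  funext i
  simp [add_assoc, CharTwo.add_self_eq_zero]

/-- If the decoder returns both error patterns from their syndromes, it corrects the Pauli
error. -/
theorem correctsPauli_of_decode {H : Matrix (Fin m) (Fin n) (ZMod 2)} {D : Bits m → Bits n}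
    {x z : Bits n} (hx : D (H *ᵥ x) = x) (hz : D (H *ᵥ z) = z) : CorrectsPauli H D x z := by
  refine ⟨H *ᵥ x, H *ᵥ z, bitSign (z ⬝ᵥ x), norm_bitSign _,
    fun ψ hψ => ⟨⟨fun i => ?_, fun i => ?_⟩, ?_⟩⟩
  · funext v
    have h1 := congrFun (hψ.2 i) (v + x)
    simp only [pauliZ, pauliX, LinearMap.coe_mk, AddHom.coe_mk, Pi.smul_apply, smul_eq_mul] at h1 ⊢
    rw [dotProduct_add, bitSign_add] at h1
    change bitSign (H i ⬝ᵥ v) * (bitSign (z ⬝ᵥ (v + x)) * ψ (v + x)) =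
      bitSign (H i ⬝ᵥ x) * (bitSign (z ⬝ᵥ (v + x)) * ψ (v + x))
    have h2 := bitSign_mul_self (H i ⬝ᵥ x)
    linear_combination bitSign (H i ⬝ᵥ x) * bitSign (z ⬝ᵥ (v + x)) * h1 -
      bitSign (H i ⬝ᵥ v) * bitSign (z ⬝ᵥ (v + x)) * ψ (v + x) * h2
  · funext v
    have h1 := congrFun (hψ.1 i) (v + x)
    simp only [pauliZ, pauliX, LinearMap.coe_mk, AddHom.coe_mk, Pi.smul_apply, smul_eq_mul] at h1 ⊢
    change bitSign (z ⬝ᵥ (v + H i + x)) * ψ (v + H i + x) =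
      bitSign (H i ⬝ᵥ z) * (bitSign (z ⬝ᵥ (v + x)) * ψ (v + x))
    rw [add_right_comm, h1, dotProduct_add, bitSign_add, dotProduct_comm z (H i)]
    ring
  · rw [hx, hz]
    funext v
    simp only [pauliZ, pauliX, LinearMap.coe_mk, AddHom.coe_mk, Pi.smul_apply, smul_eq_mul]
    rw [bits_add_add_cancel, dotProduct_add, bitSign_add]
    have h2 := bitSign_mul_self (z ⬝ᵥ v)
    linear_combination (bitSign (z ⬝ᵥ x) * ψ v) * h2

theorem mem_cssCode_iff (H : Matrix (Fin m) (Fin n) (ZMod 2)) (ψ : QState n) :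
    ψ ∈ cssCode H H ↔ (∀ i v, ψ (v + H i) = ψ v) ∧ ∀ v, H *ᵥ v ≠ 0 → ψ v = 0 := by
  refine and_congr (forall_congr' fun i => funext_iff) ⟨fun h v hv => ?_, fun h i => ?_⟩
  · by_contra h0
    refine hv (funext fun i => ?_)
    have h1 := congrFun (h i) v
    simp only [pauliZ, LinearMap.coe_mk, AddHom.coe_mk] at h1
    exact (bitSign_eq_one_iff _).1 (mul_right_cancel₀ h0 (h1.trans (one_mul _).symm))
  · funext v
    simp only [pauliZ, LinearMap.coe_mk, AddHom.coe_mk]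
    by_cases hv : H *ᵥ v = 0
    · rw [show H i ⬝ᵥ v = 0 from congrFun hv i, (bitSign_eq_one_iff 0).2 rfl, one_mul]
    · rw [h v hv, mul_zero]

/-- The states of the CSS code are the functions on the cosets of the row space in the kernel
of `H`. -/
noncomputable def cssCodeEquiv (H : Matrix (Fin m) (Fin n) (ZMod 2))
    (hH : ∀ i j, H i ⬝ᵥ H j = 0) :
    cssCode H H ≃ₗ[ℂ] ((LinearMap.ker H.mulVecLin) ⧸
      (Submodule.span (ZMod 2) (Set.range H)).comap (LinearMap.ker H.mulVecLin).subtype → ℂ) := by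
  classical
  have hinv : ∀ ψ ∈ cssCode H H, ∀ c ∈ Submodule.span (ZMod 2) (Set.range H), ∀ v,
      ψ (v + c) = ψ v := by
    intro ψ hψ c hc
    rw [mem_cssCode_iff] at hψ
    induction hc using Submodule.span_induction with
    | mem c hc =>
      obtain ⟨i, rfl⟩ := hc
      exact hψ.1 i
    | zero => simp
    | add a b _ _ ha hb =>
      intro v
      rw [← add_assoc, hb, ha]
    | smul t a _ ha =>
      intro v
      have h2 : ∀ a : ZMod 2, a = 0 ∨ a = 1 := by decide
      rcases h2 t with rfl | rfl
      · simp
      · simpa using ha v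
  have hrow : ∀ i, H i ∈ LinearMap.ker H.mulVecLin := fun i => by
    rw [LinearMap.mem_ker]
    exact funext fun j => hH j i
  exact
  { toFun := fun ψ q => Quotient.liftOn' q (fun v => (ψ : QState n) v) (by
      intro a b hab
      rw [Submodule.quotientRel_def, Submodule.mem_comap] at hab
      have := hinv ψ ψ.2 _ hab (b : Bits n)
      change (ψ : QState n) a = (ψ : QState n) b
      rw [← this]
      simp)
    map_add' := fun ψ φ => by
      funext q
      induction q using Quotient.inductionOn'
      rfl
    map_smul' := fun c ψ => by
      funext q
      induction q using Quotient.inductionOn'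
      rfl
    invFun := fun f => ⟨fun v => if hv : v ∈ LinearMap.ker H.mulVecLin then
        f (Submodule.Quotient.mk ⟨v, hv⟩) else 0, by
      rw [mem_cssCode_iff]
      refine ⟨fun i v => ?_, fun v hv => dif_neg hv⟩
      by_cases hv : v ∈ LinearMap.ker H.mulVecLin
      · rw [dif_pos hv, dif_pos (add_mem hv (hrow i))]
        congr 1
        rw [Submodule.Quotient.eq, Submodule.mem_comap]
        have : H i ∈ Submodule.span (ZMod 2) (Set.range H) := Submodule.subset_span ⟨i, rfl⟩
        simpa using this
      · rw [dif_neg hv, dif_neg]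
        intro h
        exact hv (by simpa using sub_mem h (hrow i))⟩
    left_inv := fun ψ => by
      ext v
      change (if hv : v ∈ LinearMap.ker H.mulVecLin then (ψ : QState n) v else 0) = _
      split_ifs with hv
      · rfl
      · exact (((mem_cssCode_iff H _).1 ψ.2).2 v hv).symm
    right_inv := fun f => by
      funext q
      induction q using Quotient.inductionOn' with
      | h v => exact dif_pos v.2 }

theorem finrank_cssCode {H : Matrix (Fin m) (Fin n) (ZMod 2)} (hH : H ∈ dualContained m n) :
    Module.finrank ℂ (cssCode H H) = 2 ^ (n - 2 * m) := by
  classical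
  rw [mem_dualContained] at hH
  obtain ⟨h1, h2⟩ := hH
  rw [(cssCodeEquiv H h1).finrank_eq]
  have : Fintype ((LinearMap.ker H.mulVecLin) ⧸
      (Submodule.span (ZMod 2) (Set.range H)).comap (LinearMap.ker H.mulVecLin).subtype) :=
    Fintype.ofFinite _
  rw [Module.finrank_fintype_fun_eq_card, Module.card_eq_pow_finrank (K := ZMod 2), ZMod.card]
  congr 1
  have hle : Submodule.span (ZMod 2) (Set.range H) ≤ LinearMap.ker H.mulVecLin := by
    rw [Submodule.span_le]
    rintro _ ⟨i, rfl⟩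
    exact LinearMap.mem_ker.2 (funext fun j => h1 j i)
  have e1 := Submodule.finrank_quotient_add_finrank
    ((Submodule.span (ZMod 2) (Set.range H)).comap (LinearMap.ker H.mulVecLin).subtype)
  have e2 := (Submodule.comapSubtypeEquivOfLe hle).finrank_eq
  have e3 := finrank_span_eq_card h2
  have e4 := H.mulVecLin.finrank_range_add_finrank_ker
  have e5 : H.rank = m := by simpa using LinearIndependent.rank_matrix (M := H) h2
  rw [Matrix.rank] at e5
  simp only [Module.finrank_fintype_fun_eq_card, Fintype.card_fin] at e3 e4
  omega

end CSS

/-! ### Binary entropy -/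

section Entropy

theorem binaryEntropy_eq (p : ℝ) : binaryEntropy p = Real.binEntropy p / Real.log 2 := by
  rw [binaryEntropy, Real.binEntropy, Real.logb, Real.logb, Real.log_inv, Real.log_inv]
  ring

theorem binaryEntropy_strictMonoOn : StrictMonoOn binaryEntropy (Set.Icc 0 2⁻¹) := by
  intro x hx y hy hxy
  rw [binaryEntropy_eq, binaryEntropy_eq]
  exact div_lt_div_of_pos_right (Real.binEntropy_strictMonoOn hx hy hxy) (Real.log_pos one_lt_two)

/-- Entropy of a rational number, in terms of logarithms of natural numbers. -/
theorem binaryEntropy_div {a b : ℕ} (ha : 0 < a) (hb : 0 < b) :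
    binaryEntropy (a / (a + b : ℕ)) = ((a + b : ℕ) * Real.log (a + b : ℕ) - a * Real.log a
      - b * Real.log b) / ((a + b : ℕ) * Real.log 2) := by
  have ha' : (0 : ℝ) < a := Nat.cast_pos.2 ha
  have hb' : (0 : ℝ) < b := Nat.cast_pos.2 hb
  have hab : (0 : ℝ) < (a + b : ℕ) := Nat.cast_pos.2 (by omega)
  have h2 : 0 < Real.log 2 := Real.log_pos one_lt_two
  have e : 1 - (a : ℝ) / (a + b : ℕ) = b / (a + b : ℕ) := by
    field_simp
    push_cast
    ring
  rw [binaryEntropy, e, Real.logb, Real.logb, Real.log_div ha'.ne' hab.ne',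
    Real.log_div hb'.ne' hab.ne']
  field_simp
  push_cast
  ring

/-- After clearing denominators and logarithms, an inequality of integers. -/
theorem binaryEntropy_lt_half : binaryEntropy 0.11 < 1 / 2 := by
  have h := binaryEntropy_div (a := 11) (b := 89) (by norm_num) (by norm_num)
  have h2 : 0 < Real.log 2 := Real.log_pos one_lt_two
  rw [show (0.11 : ℝ) = (11 : ℕ) / (11 + 89 : ℕ) by norm_num, h, div_lt_iff₀ (by positivity)]
  have h3 : Real.log (100 ^ 200) < Real.log (2 ^ 100 * 11 ^ 22 * 89 ^ 178) :=
    Real.log_lt_log (by norm_num) (by norm_num)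
  rw [Real.log_mul (by norm_num) (by norm_num), Real.log_mul (by norm_num) (by norm_num)] at h3
  simp only [Real.log_pow] at h3
  norm_num at h3 ⊢
  linarith

/-- The fraction `12 / 109` lies between the zero of `binaryEntropy - 1 / 2` and `0.1101`, with a
small denominator. -/
theorem half_lt_binaryEntropy : 1 / 2 < binaryEntropy (12 / 109) := by
  have h := binaryEntropy_div (a := 12) (b := 97) (by norm_num) (by norm_num)
  have h2 : 0 < Real.log 2 := Real.log_pos one_lt_two
  rw [show (12 / 109 : ℝ) = (12 : ℕ) / (12 + 97 : ℕ) by norm_num, h, lt_div_iff₀ (by positivity)]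
  have h3 : Real.log (2 ^ 109 * 12 ^ 24 * 97 ^ 194) < Real.log (109 ^ 218) :=
    Real.log_lt_log (by norm_num) (by norm_num)
  rw [Real.log_mul (by norm_num) (by norm_num), Real.log_mul (by norm_num) (by norm_num)] at h3
  simp only [Real.log_pow] at h3
  norm_num at h3 ⊢
  linarith

theorem exists_binaryEntropy_eq_half :
    ∃ τ : ℝ, 0.11 < τ ∧ τ < 0.1101 ∧ binaryEntropy τ = 1 / 2 := by
  have hc : ContinuousOn binaryEntropy (Set.Icc 0.11 (12 / 109)) := by
    rw [show binaryEntropy = fun p => Real.binEntropy p / Real.log 2 from funext binaryEntropy_eq]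
    fun_prop
  obtain ⟨τ, ⟨h1, h2⟩, h3⟩ := intermediate_value_Ioo (by norm_num) hc
    ⟨binaryEntropy_lt_half, half_lt_binaryEntropy⟩
  exact ⟨τ, h1, h2.trans (by norm_num), h3⟩

/-- The volume of a Hamming ball of radius `p n`, with `p ≤ 1 / 2`, is at most
`2 ^ (n H₂(p))`: each of its points has weight at least `2 ^ (-n H₂(p))` for independent bits of
bias `p`. -/
theorem numOf_hammingNorm_le (n : ℕ) {p : ℝ} (h0 : 0 ≤ p) (h1 : p ≤ 1 / 2) :
    numOf (fun x : Bits n => (hammingNorm x : ℝ) ≤ p * n) ≤ (2 : ℝ) ^ (n * binaryEntropy p) := by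
  classical
  rcases h0.eq_or_lt with rfl | h0
  · have h2 : numOf (fun x : Bits n => (hammingNorm x : ℝ) ≤ 0 * n) ≤ 1 := by
      rw [← numOf_eq_one (0 : Bits n)]
      refine numOf_mono fun x hx => ?_
      rw [zero_mul] at hx
      exact hammingNorm_eq_zero.1 (by exact_mod_cast le_antisymm hx (Nat.cast_nonneg _))
    simpa [binaryEntropy] using h2
  have hq : 0 < 1 - p := by linarith
  have hsum : ∑ x : Bits n, ∏ i, (if x i = 0 then 1 - p else p) = 1 := by
    rw [← Fintype.prod_sum (fun (_ : Fin n) (a : ZMod 2) => if a = 0 then 1 - p else p)]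
    refine Finset.prod_eq_one fun i _ => ?_
    rw [show (Finset.univ : Finset (ZMod 2)) = {0, 1} from rfl]
    simp
  have hprod : ∀ x : Bits n, ∏ i, (if x i = 0 then 1 - p else p) =
      p ^ hammingNorm x * (1 - p) ^ (n - hammingNorm x) := fun x => by
    rw [Finset.prod_ite, Finset.prod_const, Finset.prod_const, mul_comm]
    have e1 : (Finset.univ.filter fun i => ¬ x i = 0).card = hammingNorm x := rfl
    have e2 := Finset.card_filter_add_card_filter_not (s := Finset.univ) fun i => x i = 0
    rw [e1, Finset.card_univ, Fintype.card_fin] at e2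
    rw [e1, show (Finset.univ.filter fun i => x i = 0).card = n - hammingNorm x by omega]
  have hl2 : 0 < Real.log 2 := Real.log_pos one_lt_two
  have hpt : ∀ x : Bits n, (hammingNorm x : ℝ) ≤ p * n →
      (2 : ℝ) ^ (-(n * binaryEntropy p)) ≤ p ^ hammingNorm x * (1 - p) ^ (n - hammingNorm x) := by
    intro x hx
    have hle : hammingNorm x ≤ n := by simpa using hammingNorm_le_card_fintype (x := x)
    rw [Real.rpow_def_of_pos two_pos, ← Real.le_log_iff_exp_le (by positivity),
      Real.log_mul (by positivity) (by positivity), Real.log_pow, Real.log_pow, Nat.cast_sub hle,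
      binaryEntropy_eq, Real.binEntropy, Real.log_inv, Real.log_inv]
    have e : Real.log 2 * -(↑n * ((p * -Real.log p + (1 - p) * -Real.log (1 - p)) / Real.log 2))
        = n * (p * Real.log p + (1 - p) * Real.log (1 - p)) := by
      field_simp
      ring
    rw [e]
    have hlog : Real.log p ≤ Real.log (1 - p) := Real.log_le_log h0 (by linarith)
    nlinarith [mul_nonneg (sub_nonneg.2 hx) (sub_nonneg.2 hlog)]
  have hB := numOf_eq_sum fun x : Bits n => (hammingNorm x : ℝ) ≤ p * n
  have h3 : numOf (fun x : Bits n => (hammingNorm x : ℝ) ≤ p * n) *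
      (2 : ℝ) ^ (-(n * binaryEntropy p)) ≤ 1 := by
    rw [← hsum, hB, Finset.sum_mul]
    refine Finset.sum_le_sum fun x _ => ?_
    rw [hprod]
    split_ifs with hx
    · simpa using hpt x hx
    · rw [zero_mul]
      positivity
  rwa [Real.rpow_neg zero_le_two, ← div_eq_mul_inv, div_le_one (by positivity)] at h3

end Entropy

/-! ### Proportions in finite sets -/

section Proportions

variable {X Y : Type*}

theorem frac_eq_sum (s : Finset X) (P : X → Prop) [DecidablePred P] :
    frac s P = (∑ x ∈ s, if P x then (1 : ℝ) else 0) / s.card := by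
  rw [frac, Finset.sum_boole]
  congr!

theorem frac_nonneg (s : Finset X) (P : X → Prop) : 0 ≤ frac s P := by
  rw [frac]
  positivity

theorem frac_le_one (s : Finset X) (P : X → Prop) : frac s P ≤ 1 := by
  classical
  exact div_le_one_of_le₀ (Nat.cast_le.2 (Finset.card_filter_le _ _)) (Nat.cast_nonneg _)

theorem frac_mono {s : Finset X} {P Q : X → Prop} (h : ∀ x ∈ s, P x → Q x) :
    frac s P ≤ frac s Q := by
  classical
  refine div_le_div_of_nonneg_right (Nat.cast_le.2 (Finset.card_le_card fun x hx => ?_))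
    (Nat.cast_nonneg _)
  rw [Finset.mem_filter] at hx ⊢
  exact ⟨hx.1, h x hx.1 hx.2⟩

theorem one_sub_frac_not {s : Finset X} (hs : s.Nonempty) (P : X → Prop) :
    1 - frac s (fun x => ¬ P x) = frac s P := by
  classical
  have h0 : (0 : ℝ) < s.card := Nat.cast_pos.2 (Finset.card_pos.2 hs)
  rw [frac_eq_sum, frac_eq_sum, one_sub_div h0.ne']
  congr 1
  rw [sub_eq_iff_eq_add, ← Finset.sum_add_distrib, Finset.card_eq_sum_ones, Nat.cast_sum]
  refine Finset.sum_congr rfl fun x _ => ?_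
  by_cases h : P x <;> simp [h]

theorem frac_product (s : Finset X) (t : Finset Y) (P : X → Prop) (Q : Y → Prop) :
    frac (s ×ˢ t) (fun e => P e.1 ∧ Q e.2) = frac s P * frac t Q := by
  classical
  rw [frac_eq_sum, frac_eq_sum, frac_eq_sum, Finset.card_product, Nat.cast_mul,
    div_mul_div_comm, Finset.sum_mul_sum, Finset.sum_product]
  congr 1
  refine Finset.sum_congr rfl fun x _ => Finset.sum_congr rfl fun y _ => ?_
  by_cases h1 : P x <;> by_cases h2 : Q y <;> simp [h1, h2]

/-- Markov's inequality. -/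
theorem frac_lt_le {s : Finset X} {f : X → ℝ} (hf : ∀ x ∈ s, 0 ≤ f x) {c : ℝ} (hc : 0 < c) :
    frac s (fun x => c < f x) ≤ (∑ x ∈ s, f x) / s.card / c := by
  classical
  rw [frac_eq_sum, div_right_comm]
  refine div_le_div_of_nonneg_right ?_ (Nat.cast_nonneg _)
  rw [Finset.sum_div]
  refine Finset.sum_le_sum fun x hx => ?_
  split_ifs with h
  · exact ((one_lt_div hc).2 h).le
  · exact div_nonneg (hf x hx) hc.le

end Proportions

/-! ### Random coding -/

section Decoding

variable {m n : ℕ}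

/-- Some error pattern of weight at most `p n` other than `x` has the same syndrome as `x`. -/
def IsAmbiguous (H : Matrix (Fin m) (Fin n) (ZMod 2)) (p : ℝ) (x : Bits n) : Prop :=
  ∃ y, y ≠ x ∧ (hammingNorm y : ℝ) ≤ p * n ∧ H *ᵥ y = H *ᵥ x

open Classical in
/-- The decoder that returns some error pattern of weight at most `p n` with the given syndrome,
if there is one, and `0` otherwise. -/
noncomputable def ballDecoder (H : Matrix (Fin m) (Fin n) (ZMod 2)) (p : ℝ) (s : Bits m) : Bits n :=
  if h : ∃ y : Bits n, (hammingNorm y : ℝ) ≤ p * n ∧ H *ᵥ y = s then h.choose else 0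

theorem ballDecoder_apply {H : Matrix (Fin m) (Fin n) (ZMod 2)} {p : ℝ} {x : Bits n}
    (hx : (hammingNorm x : ℝ) ≤ p * n) (h : ¬ IsAmbiguous H p x) :
    ballDecoder H p (H *ᵥ x) = x := by
  have h1 : ∃ y : Bits n, (hammingNorm y : ℝ) ≤ p * n ∧ H *ᵥ y = H *ᵥ x := ⟨x, hx, rfl⟩
  rw [ballDecoder, dif_pos h1]
  by_contra h2
  exact h ⟨_, h2, h1.choose_spec⟩

/-- The sum over the weights `w ≤ p n` of the proportion of ambiguous error patterns of
weight `w`. -/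
noncomputable def ambiguityRate (H : Matrix (Fin m) (Fin n) (ZMod 2)) (p : ℝ) : ℝ :=
  ∑ w ∈ Finset.range (n + 1),
    if (w : ℝ) ≤ p * n then frac (errorsOfWeight n w) (IsAmbiguous H p) else 0

theorem ambiguityRate_nonneg (H : Matrix (Fin m) (Fin n) (ZMod 2)) (p : ℝ) :
    0 ≤ ambiguityRate H p :=
  Finset.sum_nonneg fun w _ => by
    split_ifs
    · exact frac_nonneg _ _
    · exact le_rfl

theorem le_of_cast_le_mul {p : ℝ} (hp : p ≤ 1) {w : ℕ} (hw : (w : ℝ) ≤ p * n) : w ≤ n := by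
  have h : p * n ≤ 1 * n := mul_le_mul_of_nonneg_right hp (Nat.cast_nonneg _)
  rw [one_mul] at h
  exact_mod_cast hw.trans h

theorem errorsOfWeight_nonempty {w : ℕ} (hw : w ≤ n) : (errorsOfWeight n w).Nonempty := by
  classical
  obtain ⟨S, -, hS⟩ := Finset.exists_subset_card_eq (s := (Finset.univ : Finset (Fin n)))
    (n := w) (by simpa using hw)
  refine ⟨fun i => if i ∈ S then 1 else 0, ?_⟩
  simp [errorsOfWeight, hammingNorm, hS]

theorem frac_isAmbiguous_le_ambiguityRate (H : Matrix (Fin m) (Fin n) (ZMod 2)) {p : ℝ}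
    (hp : p ≤ 1) {w : ℕ} (hw : (w : ℝ) ≤ p * n) :
    frac (errorsOfWeight n w) (IsAmbiguous H p) ≤ ambiguityRate H p := by
  have h := Finset.single_le_sum (f := fun w : ℕ =>
    if (w : ℝ) ≤ p * n then frac (errorsOfWeight n w) (IsAmbiguous H p) else 0)
    (fun w _ => by
      split_ifs
      · exact frac_nonneg _ _
      · exact le_rfl)
    (Finset.mem_range.2 (Nat.lt_succ_of_le (le_of_cast_le_mul hp hw)))
  rw [ambiguityRate]
  simpa only [if_pos hw] using h

/-- A small ambiguity rate bounds the proportion of ambiguous patterns for all weights at once; a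
pair of error patterns is corrected unless one of them is ambiguous. -/
theorem correctsFraction_of_ambiguityRate_le {H : Matrix (Fin m) (Fin n) (ZMod 2)} {p η : ℝ}
    (hp : p ≤ 1) (hη : 0 < η) (h : ambiguityRate H p ≤ η / 2) :
    CorrectsFraction H (ballDecoder H p) p η := by
  have key : ∀ w : ℕ, (w : ℝ) ≤ p * n →
      1 - η / 2 ≤ frac (errorsOfWeight n w) (fun x => ballDecoder H p (H *ᵥ x) = x) := by
    intro w hw
    have h1 := frac_isAmbiguous_le_ambiguityRate H hp hw
    have h2 := one_sub_frac_not (errorsOfWeight_nonempty (le_of_cast_le_mul hp hw))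
      fun x => ¬ IsAmbiguous H p x
    simp only [not_not] at h2
    have h3 : frac (errorsOfWeight n w) (fun x => ¬ IsAmbiguous H p x) ≤
        frac (errorsOfWeight n w) (fun x => ballDecoder H p (H *ᵥ x) = x) :=
      frac_mono fun x hx => ballDecoder_apply (by
        rw [errorsOfWeight, Finset.mem_filter] at hx
        rwa [hx.2])
    linarith
  refine ⟨fun w hw => (by linarith : 1 - η ≤ 1 - η / 2).trans (key w hw), fun wx wz hx hz => ?_⟩
  refine le_trans ?_ (frac_mono (P := fun e => ballDecoder H p (H *ᵥ e.1) = e.1 ∧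
    ballDecoder H p (H *ᵥ e.2) = e.2) fun e _ he => correctsPauli_of_decode he.1 he.2)
  rw [frac_product (errorsOfWeight n wx) (errorsOfWeight n wz)
    (fun x => ballDecoder H p (H *ᵥ x) = x) fun x => ballDecoder H p (H *ᵥ x) = x]
  have a1 := key wx hx
  have a2 := key wz hz
  have b1 := frac_le_one (errorsOfWeight n wx) fun x => ballDecoder H p (H *ᵥ x) = x
  have b2 := frac_le_one (errorsOfWeight n wz) fun x => ballDecoder H p (H *ᵥ x) = x
  nlinarith [mul_nonneg (sub_nonneg.2 b1) (sub_nonneg.2 b2)]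

theorem hammingNorm_bits_add_le (x y : Bits n) :
    hammingNorm (x + y) ≤ hammingNorm x + hammingNorm y := by
  have h := hammingDist_triangle x 0 (-y)
  rw [hammingDist_eq_hammingNorm, hammingDist_comm 0, hammingDist_zero_right,
    hammingDist_zero_right] at h
  have h2 : ∀ v : Bits n, -v = v := fun v => funext fun i => ZMod.neg_eq_self_mod_two _
  rwa [h2, h2] at h

/-- First-moment bound: if every nonzero vector of weight below `n / 2` is annihilated with
probability at most `q`, then the average ambiguity rate over all `H` is at most `n + 1` times `q`
times the volume of the ball of radius `p n`. The assumption `p < 1 / 4` keeps the sum of two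
patterns in the ball below weight `n / 2`. -/
theorem sum_ambiguityRate_le {p q : ℝ} (hp : p < 1 / 4) (hn : 0 < n)
    (hq0 : 0 ≤ q) (hq : ∀ u : Bits n, u ≠ 0 → 2 * hammingNorm u < n →
      frac (dualContained m n) (fun H => H *ᵥ u = 0) ≤ q) :
    ∑ H ∈ dualContained m n, ambiguityRate H p ≤ (dualContained m n).card *
      ((n + 1) * (numOf (fun x : Bits n => (hammingNorm x : ℝ) ≤ p * n) * q)) := by
  classical
  set B := numOf (fun x : Bits n => (hammingNorm x : ℝ) ≤ p * n) with hB
  set d : ℝ := ((dualContained m n).card : ℝ)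
  have hpt : ∀ x : Bits n, (hammingNorm x : ℝ) ≤ p * n →
      (∑ H ∈ dualContained m n, if IsAmbiguous H p x then (1 : ℝ) else 0) ≤ d * (B * q) := by
    intro x hx
    have h1 : ∀ H : Matrix (Fin m) (Fin n) (ZMod 2), (if IsAmbiguous H p x then (1 : ℝ) else 0) ≤
        ∑ y : Bits n, if (hammingNorm y : ℝ) ≤ p * n then
          (if y ≠ x ∧ H *ᵥ (x + y) = 0 then (1 : ℝ) else 0) else 0 := by
      intro H
      have hnn : ∀ y : Bits n, 0 ≤ if (hammingNorm y : ℝ) ≤ p * n then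
          (if y ≠ x ∧ H *ᵥ (x + y) = 0 then (1 : ℝ) else 0) else 0 := fun y => by
        split_ifs <;> norm_num
      split_ifs with h
      · obtain ⟨y, hy1, hy2, hy3⟩ := h
        refine le_trans ?_ (Finset.single_le_sum (fun y _ => hnn y) (Finset.mem_univ y))
        rw [if_pos hy2, if_pos]
        refine ⟨hy1, ?_⟩
        rw [Matrix.mulVec_add, hy3]
        exact funext fun i => CharTwo.add_self_eq_zero _
      · exact Finset.sum_nonneg fun y _ => hnn y
    refine (Finset.sum_le_sum fun H _ => h1 H).trans ?_
    rw [Finset.sum_comm, hB, numOf_eq_sum, Finset.sum_mul, Finset.mul_sum]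
    refine Finset.sum_le_sum fun y _ => ?_
    by_cases hy : (hammingNorm y : ℝ) ≤ p * n
    · simp only [hy, if_true, one_mul]
      by_cases hyx : y = x
      · simpa [hyx] using mul_nonneg (Nat.cast_nonneg _) hq0
      · simp only [hyx, ne_eq, not_false_eq_true, true_and]
        have hu : x + y ≠ 0 := fun h => hyx (funext fun i =>
          (CharTwo.add_eq_zero.1 (congrFun h i)).symm)
        have hw : 2 * hammingNorm (x + y) < n := by
          have h2 : (hammingNorm (x + y) : ℝ) ≤ hammingNorm x + hammingNorm y := by
            exact_mod_cast hammingNorm_bits_add_le x y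
          have hn' : (0 : ℝ) < n := Nat.cast_pos.2 hn
          have h3 : (2 * hammingNorm (x + y) : ℝ) < n := by nlinarith
          exact_mod_cast h3
        have h4 := hq _ hu hw
        rw [frac_eq_sum] at h4
        rcases (Nat.cast_nonneg (α := ℝ) (dualContained m n).card).eq_or_lt with h0 | h0
        · have h5 : dualContained m n = ∅ := Finset.card_eq_zero.1 (Nat.cast_eq_zero.1 h0.symm)
          simp [d, h5]
        · rw [div_le_iff₀ h0] at h4
          rw [mul_comm]
          exact h4
    · simp [hy]
  have hw : ∀ w : ℕ, (∑ H ∈ dualContained m n,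
      if (w : ℝ) ≤ p * n then frac (errorsOfWeight n w) (IsAmbiguous H p) else 0)
        ≤ d * (B * q) := by
    intro w
    have hnn : 0 ≤ d * (B * q) := mul_nonneg (Nat.cast_nonneg _) (mul_nonneg (numOf_nonneg _) hq0)
    by_cases h : (w : ℝ) ≤ p * n
    · simp only [h, if_true, frac_eq_sum]
      rw [← Finset.sum_div, Finset.sum_comm]
      refine div_le_of_le_mul₀ (Nat.cast_nonneg _) hnn ?_
      rw [mul_comm, ← nsmul_eq_mul, ← Finset.sum_const]
      refine Finset.sum_le_sum fun x hx => hpt x ?_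
      rw [errorsOfWeight, Finset.mem_filter] at hx
      rwa [hx.2]
    · simpa [h] using hnn
  simp only [ambiguityRate]
  rw [Finset.sum_comm]
  refine (Finset.sum_le_sum fun w _ => hw w).trans_eq ?_
  rw [Finset.sum_const, Finset.card_range, nsmul_eq_mul]
  push_cast
  ring

theorem numChecks_le {p ε : ℝ} (h0 : 0 ≤ p) (hp : p < 1 / 4)
    (h : binaryEntropy p < 1 / 2 - ε) (n : ℕ) :
    (numChecks ε n : ℝ) ≤ (n : ℝ) / 2 - n * ε := by
  have h1 : 0 ≤ binaryEntropy p := by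
    rw [binaryEntropy_eq]
    exact div_nonneg (Real.binEntropy_nonneg h0 (by linarith)) (Real.log_nonneg one_le_two)
  refine Nat.floor_le ?_
  have : (0 : ℝ) ≤ n * (1 / 2 - ε) := mul_nonneg (Nat.cast_nonneg n) (by linarith)
  linarith

/-- Below the entropy bound, the average ambiguity rate over the dual-contained matrices tends
to `0`. -/
theorem tendsto_average_ambiguityRate {p ε : ℝ} (h0 : 0 ≤ p) (hp : p < 1 / 4) (hε : 0 < ε)
    (h : binaryEntropy p < 1 / 2 - ε) :
    Tendsto (fun n : ℕ => (∑ H ∈ dualContained (numChecks ε n) n, ambiguityRate H p) /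
      (dualContained (numChecks ε n) n).card) atTop (𝓝 0) := by
  have hlim := (tendsto_mul_rpow_neg (sub_pos.2 h)).const_mul 4
  rw [mul_zero] at hlim
  refine squeeze_zero' (Eventually.of_forall fun n => div_nonneg
    (Finset.sum_nonneg fun H _ => ambiguityRate_nonneg H p) (Nat.cast_nonneg _)) ?_ hlim
  filter_upwards [eventually_dualContained hε one_pos, eventually_gt_atTop 0] with n hD hn
  have hm := numChecks_le h0 hp h n
  have hc : (0 : ℝ) < (dualContained (numChecks ε n) n).card :=
    Nat.cast_pos.2 (Finset.card_pos.2 (dualContained_nonempty_of_le hε hm))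
  have hq : ∀ u : Bits n, u ≠ 0 → 2 * hammingNorm u < n →
      frac (dualContained (numChecks ε n) n) (fun H => H *ᵥ u = 0) ≤
        2 / 2 ^ numChecks ε n := by
    intro u hu hw
    have h1 := (hD _ hm).2.2 u 0 hu (by rwa [add_zero])
    rw [add_zero] at h1
    rw [le_div_iff₀ (by positivity), mul_comm]
    linarith [(abs_le.1 h1).2]
  rw [div_le_iff₀ hc, mul_comm]
  refine (sum_ambiguityRate_le hp hn (by positivity) hq).trans (mul_le_mul_of_nonneg_left ?_ hc.le)
  have hB := numOf_hammingNorm_le n h0 (by linarith : p ≤ 1 / 2)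
  -- Rounding down the number of checks costs at most a factor of two.
  have hfl : (2 : ℝ) ^ (n / 2 - n * ε : ℝ) ≤ 2 * 2 ^ numChecks ε n := by
    rw [← pow_succ', ← Real.rpow_natCast]
    refine Real.rpow_le_rpow_of_exponent_le one_le_two ?_
    push_cast
    exact (Nat.lt_floor_add_one _).le
  have e : (2 : ℝ) ^ (n * binaryEntropy p) =
      (2 : ℝ) ^ (-(n * (1 / 2 - ε - binaryEntropy p))) * (2 : ℝ) ^ (n / 2 - n * ε : ℝ) := by
    rw [← Real.rpow_add two_pos]
    congr 1
    ring
  have hprod : numOf (fun x : Bits n => (hammingNorm x : ℝ) ≤ p * n) * (2 / 2 ^ numChecks ε n) ≤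
      4 * (2 : ℝ) ^ (-(n * (1 / 2 - ε - binaryEntropy p))) := by
    rw [mul_div_assoc', div_le_iff₀ (by positivity)]
    have hr : (0 : ℝ) ≤ (2 : ℝ) ^ (-(n * (1 / 2 - ε - binaryEntropy p))) := by positivity
    rw [e] at hB
    have := mul_le_mul_of_nonneg_left hfl hr
    linarith
  calc _ ≤ ((n : ℝ) + 1) * (4 * (2 : ℝ) ^ (-(n * (1 / 2 - ε - binaryEntropy p)))) :=
        mul_le_mul_of_nonneg_left hprod (by positivity)
    _ = _ := by ring

/-- Some matrix does at least as well as the average, and the average tends to zero. -/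
theorem exists_code_family {p ε : ℝ} (h0 : 0 ≤ p) (hp : p < 1 / 4) (hε : 0 < ε)
    (h : binaryEntropy p < 1 / 2 - ε) :
    ∃ (H : (n : ℕ) → Matrix (Fin (numChecks ε n)) (Fin n) (ZMod 2))
        (D : (n : ℕ) → Bits (numChecks ε n) → Bits n),
      (∀ n, H n ∈ dualContained (numChecks ε n) n) ∧
      (∀ n, Module.finrank ℂ (cssCode (H n) (H n)) = 2 ^ (n - 2 * numChecks ε n)) ∧
      ∀ η : ℝ, 0 < η → ∀ᶠ n in atTop, CorrectsFraction (H n) (D n) p η := by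
  have hex : ∀ n, ∃ H ∈ dualContained (numChecks ε n) n, ambiguityRate H p ≤
      (∑ H ∈ dualContained (numChecks ε n) n, ambiguityRate H p) /
        (dualContained (numChecks ε n) n).card := fun n => by
    have hne := dualContained_nonempty_of_le hε (numChecks_le h0 hp h n)
    refine Finset.exists_le_of_sum_le hne ?_
    have hc : ((dualContained (numChecks ε n) n).card : ℝ) ≠ 0 :=
      Nat.cast_ne_zero.2 (Finset.card_pos.2 hne).ne'
    rw [Finset.sum_const, nsmul_eq_mul, mul_div_cancel₀ _ hc]
  choose H hH hle using hex
  refine ⟨H, fun n => ballDecoder (H n) p, hH, fun n => finrank_cssCode (hH n), fun η hη => ?_⟩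
  filter_upwards [(tendsto_average_ambiguityRate h0 hp hε h).eventually_le_const (half_pos hη)]
    with n hn
  exact correctsFraction_of_ambiguityRate_le (by linarith) hη ((hle n).trans hn)

/-- Markov's inequality turns the bound for the average into one for almost every matrix. -/
theorem tendsto_frac_correctsFraction {p ε η : ℝ} (h0 : 0 ≤ p) (hp : p < 1 / 4) (hε : 0 < ε)
    (h : binaryEntropy p < 1 / 2 - ε) (hη : 0 < η) :
    Tendsto (fun n : ℕ => frac (dualContained (numChecks ε n) n)
      (fun H => ∃ D, CorrectsFraction H D p η)) atTop (𝓝 1) := by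
  have hlim := (tendsto_average_ambiguityRate h0 hp hε h).div_const (η / 2)
  rw [zero_div] at hlim
  have hlow := hlim.const_sub 1
  rw [sub_zero] at hlow
  refine tendsto_of_tendsto_of_tendsto_of_le_of_le hlow tendsto_const_nhds (fun n => ?_)
    fun n => frac_le_one _ _
  have hne := dualContained_nonempty_of_le hε (numChecks_le h0 hp h n)
  have h1 := frac_lt_le (s := dualContained (numChecks ε n) n) (f := fun H => ambiguityRate H p)
    (fun H _ => ambiguityRate_nonneg H p) (half_pos hη)
  have h2 : frac (dualContained (numChecks ε n) n) (fun H => ¬ ∃ D, CorrectsFraction H D p η) ≤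
      frac (dualContained (numChecks ε n) n) fun H => η / 2 < ambiguityRate H p :=
    frac_mono fun H _ hH => by
      by_contra h3
      exact hH ⟨_, correctsFraction_of_ambiguityRate_le (by linarith) hη (not_lt.1 h3)⟩
  have h3 := one_sub_frac_not hne fun H => ∃ D, CorrectsFraction H D p η
  dsimp only
  linarith

end Decoding

theorem mainTheorem3 :
    -- the construction (with `n = h + h`) halts with probability `O(2 ^ (-n ε))`
    (∃ C : ℝ, ∀ ε : ℝ, 0 < ε → ∀ h m : ℕ,
      (m : ℝ) ≤ ((h + h : ℕ) : ℝ) / 2 - ((h + h : ℕ) : ℝ) * ε →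
      (construction m h none).toReal ≤ C * (2 : ℝ) ^ (-(((h + h : ℕ) : ℝ) * ε))) ∧
    -- it generates only dual-contained matrices with independent rows, and almost all of them
    (∀ h m : ℕ, generated m h ⊆ (dualContained m (h + h) : Set _)) ∧
    (∀ ε : ℝ, 0 < ε → ∀ δ : ℝ, 0 < δ → ∀ᶠ h : ℕ in atTop, ∀ m : ℕ,
      (m : ℝ) ≤ ((h + h : ℕ) : ℝ) / 2 - ((h + h : ℕ) : ℝ) * ε →
      |((generated m h).ncard : ℝ) / countModel m (h + h) - 1| ≤ δ ∧
      |((generated m h).ncard : ℝ) / ((dualContained m (h + h)).card : ℝ) - 1| ≤ δ) ∧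
    -- for random dual-contained matrices: the total number, the law of at most half of the
    -- columns, and the probability that two errors have the same syndrome
    (∀ ε : ℝ, 0 < ε → ∀ δ : ℝ, 0 < δ → ∀ᶠ n : ℕ in atTop, ∀ m : ℕ,
      (m : ℝ) ≤ (n : ℝ) / 2 - n * ε →
      |((dualContained m n).card : ℝ) / countModel m n - 1| ≤ δ ∧
      (∀ S : Finset (Fin n), 2 * S.card ≤ n → columnsTV m n S ≤ δ) ∧
      (∀ x y : Bits n, x ≠ y → 2 * hammingNorm (x + y) < n →
        |2 ^ m * frac (dualContained m n) (fun H => H *ᵥ (x + y) = 0) - 1| ≤ δ)) ∧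
    -- the correctable error fraction
    (∃ τ : ℝ, 0.11 < τ ∧ τ < 0.1101 ∧ binaryEntropy τ = 1 / 2 ∧
      ∀ p : ℝ, 0 ≤ p → p < τ → binaryEntropy p < 1 / 2 ∧
        ∀ ε : ℝ, 0 < ε → binaryEntropy p < 1 / 2 - ε →
          -- almost every dual-contained matrix gives good codes
          (∀ η : ℝ, 0 < η → Tendsto
            (fun n : ℕ => frac (dualContained (numChecks ε n) n)
              (fun H => ∃ D, CorrectsFraction H D p η)) atTop (𝓝 1)) ∧
          -- and there is a family of codes whose success probability tends to one
          (∃ (H : (n : ℕ) → Matrix (Fin (numChecks ε n)) (Fin n) (ZMod 2))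
              (D : (n : ℕ) → Bits (numChecks ε n) → Bits n),
            (∀ n, H n ∈ dualContained (numChecks ε n) n) ∧
            (∀ n, Module.finrank ℂ (cssCode (H n) (H n)) = 2 ^ (n - 2 * numChecks ε n)) ∧
            ∀ η : ℝ, 0 < η → ∀ᶠ n in atTop, CorrectsFraction (H n) (D n) p η)) := by
  refine ⟨⟨5, fun ε _ h m hm => toReal_construction_none_le hm⟩,
    fun h m => generated_subset_dualContained h m, fun ε hε δ hδ => eventually_generated hε hδ,
    fun ε hε δ hδ => eventually_dualContained hε hδ, ?_⟩
  obtain ⟨τ, h1, h2, h3⟩ := exists_binaryEntropy_eq_half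
  refine ⟨τ, h1, h2, h3, fun p h0 hp => ⟨?_, fun ε hε h => ⟨fun η hη => ?_, ?_⟩⟩⟩
  · rw [← h3]
    exact binaryEntropy_strictMonoOn ⟨h0, by linarith⟩ ⟨by linarith, by linarith⟩ hp
  · exact tendsto_frac_correctsFraction h0 (by linarith) hε h hη
  · exact exists_code_family h0 (by linarith) hε h
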